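/- **Setting.** Let $a\in\{0,1\}^n$ be the past state of a bus and $b\in\{0,1\}^n$ its next state. The state $b$ is a *CAC word* (crosstalk-avoidance codeword) for $a$ if no two adjacent wires make opposing transitions (one $0\to1$, the other $1\to0$). Let $R_{\mathsf{ECC}}\in(3/4,1]$, and let $L(x),R(x)$ be polynomials with nonnegative coefficients, $L(1)=R(1)=1$, $L'(1),R'(1)>0$ and $L'(1)/R'(1)=1/R_{\mathsf{ECC}}-1$ (node-perspective degree distributions of information variable nodes and of ECC checks), with edge-perspective distributions $\lambda(x)=L'(x)/L'(1)$ and $\rho(x)=R'(x)/R'(1)$. Let $\varepsilon\in[0,1]$. In the joint IRA/CAC ensemble, the information wires are divided into independent alternating runs ($0101\dots$ or $1010\dots$ in the past state, each with probability $1/2$) whose length $D$ satisfies $\Pr(D=1)=\frac{2R_{\mathsf{ECC}}-3/2}{2R_{\mathsf{ECC}}-1}$ and $\Pr(D=d)=\frac{2^{-d}}{2R_{\mathsf{ECC}}-1}$ for $d\ge2$; each run is one CAC check node, and the bits on it are uniformly distributed over the CAC words of the run. The information variable nodes are connected to ECC checks as in the LDPC ensemble given by $(L,R)$. Each ECC check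 is moreover connected to two consecutive parity variable nodes of an accumulate chain, and each parity variable node to two consecutive ECC checks; the bits at an ECC check sum to $0$ modulo $2$. Every wire is erased independently with probability $\varepsilon$. The iterative decoder passes messages in $\{0,1,?\}$, initially all $?$ ($?$ denotes an erasure). A variable node sends $?$ if its channel output and all its other incoming messages are $?$, and the value of a non-erased one otherwise, except that a message to a CAC check uses only the channel output and the messages from ECC checks. An ECC check sends the XOR of its other incoming messages if none of them is $?$, and $?$ otherwise. A CAC check sends to a wire of its run the past value of that wire if the incoming message from a neighbouring wire of the same run is non-erased and differs from the past value of that neighbouring wire (the wire is then forced not to switch), and $?$ otherwise. In each round $r=0,1,2,\dots$ messages are sent from information variable nodes to CAC checks, back from CAC checks to information variable nodes, from information variable nodes to ECC checks, $s$ times back and forth between ECC checks and parity variable nodes (on the accumulate chain), and from ECC checks to information variable nodes. Density evolution considers this decoder on the cycle-free random decoding neighbourhoods of the ensemble: a neighbourhood is a tree whose node degrees are independent with the above (node- or edge-perspective) distributions. Let $x_{\mathsf{CAC}},y_{\mathsf{CAC}},x_{\mathsf{ECC}},y_{\mathsf{ECC}},x_{\mathsf P},y_{\mathsf P}$ be the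 probabilities that the message on a random edge is $?$, where $x$ stands for messages sent by variable nodes and $y$ for messages received by them; $\mathsf{CAC}$ and $\mathsf{ECC}$ refer to the edges between information variable nodes and CAC checks, respectively ECC checks, and $\mathsf P$ to the edges between parity variable nodes and ECC checks. The superscript $(r)$ denotes the messages of round $r$, except that $y_{\mathsf{ECC}}^{(r)}$ refers to the beginning of round $r$. Let $F$ be the Fibonacci numbers, $F(1)=F(2)=1$, and for $d\ge2$, $1\le i\le d$ let $p_{d,i}(x)=(1-x)p^{(1)}_{d,i}+(1-x^2)p^{(2)}_{d,i}$, where $p^{(1)}_{d,1}=p^{(1)}_{d,d}=\frac{F(d-1)}{F(d+2)}$, $p^{(2)}_{d,1}=p^{(2)}_{d,d}=0$, and for $2\le i\le d-1$ $$p^{(1)}_{d,i}=\frac{F(i-1)F(d-i+1)+F(i)F(d-i)}{F(d+2)},\qquad p^{(2)}_{d,i}=\frac{F(i-1)F(d-i)}{F(d+2)}.$$ **Theorem.** The probability $\tilde\rho_d$ that a random edge of the CAC part is connected to a CAC check of degree $d$ is $\tilde\rho_1=1-\frac{3}{4R_{\mathsf{ECC}}}$ and $\tilde\rho_d=\frac{d\,2^{-d-1}}{R_{\mathsf{ECC}}}$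 for $d\ge2$. If the messages on the accumulate chain are exchanged until convergence (that is, in the limit $s\to\infty$, which exists for all six quantities in every round), then $y_{\mathsf{ECC}}^{(0)}=1$ and for all $r\ge0$ $$\begin{aligned} x_{\mathsf{CAC}}^{(r)}&=\varepsilon L\bigl(y_{\mathsf{ECC}}^{(r)}\bigr), & y_{\mathsf{CAC}}^{(r)}&=1-\sum_{d=2}^\infty\frac{\tilde\rho_d}{d}\sum_{i=1}^d p_{d,i}\bigl(x_{\mathsf{CAC}}^{(r)}\bigr),\\ x_{\mathsf{ECC}}^{(r)}&=\varepsilon\, y_{\mathsf{CAC}}^{(r)}\lambda\bigl(y_{\mathsf{ECC}}^{(r)}\bigr), & y_{\mathsf{ECC}}^{(r+1)}&=1-\bigl(1-x_{\mathsf P}^{(r)}\bigr)^2\rho\bigl(1-x_{\mathsf{ECC}}^{(r)}\bigr),\\ x_{\mathsf P}^{(r)}&=\varepsilon\, y_{\mathsf P}^{(r)}, & y_{\mathsf P}^{(r)}&=1-\bigl(1-x_{\mathsf P}^{(r)}\bigr)R\bigl(1-x_{\mathsf{ECC}}^{(r)}\bigr). \end{aligned}$$ For every finite number $s$ of exchanges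 the same equations hold exactly, with the two equations for $\mathsf P$ replaced by $x_{\mathsf P}^{(r,0)}=\varepsilon$, $x_{\mathsf P}^{(r,i+1)}=\varepsilon y_{\mathsf P}^{(r,i)}$, $y_{\mathsf P}^{(r,i)}=1-(1-x_{\mathsf P}^{(r,i)})R(1-x_{\mathsf{ECC}}^{(r)})$ for $i\geq 0$, where $i$ counts the exchanges within the round, and with $x_{\mathsf P}^{(r)}=x_{\mathsf P}^{(r,s)}$. -/

import Mathlib

open Polynomial Filter Topology
open scoped ENNReal

noncomputable section

namespace JointCAC

/-! ### Messages and node updates of the iterative erasure decoder -/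

/-- A message: `none` is the erasure symbol `?`, `some b` is the bit `b`. -/
abbrev Msg := Option Bool

/-- Variable-node update: an erasure if the channel value and all incoming messages are erasures,
otherwise the value of a non-erased one. -/
def varUpdate (channel : Msg) {k : ℕ} (m : Fin k → Msg) : Msg :=
  (channel :: List.ofFn m).findSome? id

/-- ECC-check update: the XOR of the incoming messages if none of them is erased,
otherwise an erasure. -/
def eccUpdate {k : ℕ} (m : Fin k → Msg) : Msg :=
  (List.ofFn m).foldr (fun x acc => Option.map₂ xor x acc) (some false)

/-- The constraint of two adjacent wires with past values `aNbr`, `aSelf` forbids opposing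
transitions. If the past values differ and the neighbour is known to switch to `!aNbr`, then the
wire has to keep the value `aSelf`; otherwise nothing is known. (For past `(0, 1)`: left `1` forces
right `1`, and right `0` forces left `0`.) -/
def cacPairUpdate (aNbr aSelf : Bool) (m : Msg) : Msg :=
  if aNbr ≠ aSelf ∧ m = some (!aNbr) then some aSelf else none

/-- The update of the CAC-check node of a run of wires with past values `a`, towards wire `i`: the
combination of the pairwise updates from its left and its right neighbour within the run. -/
def cacUpdate {d : ℕ} (a : Fin d → Bool) (m : Fin d → Msg) (i : Fin d) : Msg :=
  (if _h : 0 < i.val then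
      cacPairUpdate (a ⟨i.val - 1, by omega⟩) (a i) (m ⟨i.val - 1, by omega⟩)
    else none).or
  (if h : i.val + 1 < d then
      cacPairUpdate (a ⟨i.val + 1, h⟩) (a i) (m ⟨i.val + 1, h⟩)
    else none)

/-! ### Crosstalk-avoidance codewords of an alternating run -/

/-- The alternating run of length `d` that starts with the bit `phase`. -/
def altRun (phase : Bool) (d : ℕ) : Fin d → Bool :=
  fun j => if j.val % 2 = 0 then phase else !phase

/-- The wires `i` and `j` make opposing transitions, one going up and the other one down, when the
bus changes from `a` to `b`. -/
def Opposing {d : ℕ} (a b : Fin d → Bool) (i j : Fin d) : Prop :=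
  a i ≠ b i ∧ a j ≠ b j ∧ a i ≠ a j

/-- `b` is a crosstalk-avoidance codeword for the past state `a`: no two adjacent wires make
opposing transitions. -/
def IsCACWord {d : ℕ} (a b : Fin d → Bool) : Prop :=
  ∀ i j : Fin d, j.val = i.val + 1 → ¬ Opposing a b i j

/-- The set of all crosstalk-avoidance codewords for the past state `a`. -/
def cacWords {d : ℕ} (a : Fin d → Bool) : Finset (Fin d → Bool) :=
  open Classical in Finset.univ.filter (IsCACWord a)

theorem cacWords_nonempty {d : ℕ} (a : Fin d → Bool) : (cacWords a).Nonempty :=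
  ⟨a, by simp [cacWords, IsCACWord, Opposing]⟩

/-- An alternating run of `n + 1` wires, a codeword on it, and a distinguished wire. -/
structure Run where
  n : ℕ
  phase : Bool
  word : Fin (n + 1) → Bool
  pos : Fin (n + 1)

/-- The past values on the wires of the run. -/
def Run.past (ω : Run) : Fin (ω.n + 1) → Bool := altRun ω.phase (ω.n + 1)

/-- The bit on the distinguished wire. -/
def Run.bit (ω : Run) : Bool := ω.word ω.pos

/-! ### Decoding neighbourhoods

A decoding neighbourhood of a directed edge is the tree of all nodes that the message on this edge
depends on, with the transmitted bits and the erasures of the channel. `silent` stands for an edge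
on which nothing has been sent yet. -/

mutual
/-- Neighbourhood of an edge from an information variable node to an ECC check. -/
inductive InfoToEcc : Type
  | node (erased : Bool) (cac : CacToInfo) (k : ℕ) (checks : Fin k → EccToInfo)
/-- Neighbourhood of an edge from an information variable node to a CAC check. -/
inductive InfoToCac : Type
  | node (bit erased : Bool) (k : ℕ) (checks : Fin k → EccToInfo)
/-- Neighbourhood of an edge from the CAC check of a run to the variable node on the distinguished
wire of the run; the `j`-th other wire of the run is at position `ω.pos.succAbove j`. -/
inductive CacToInfo : Type
  | node (ω : Run) (others : Fin ω.n → InfoToCac)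
/-- Neighbourhood of an edge from an ECC check to an information variable node. The check has `k`
other information variable nodes and two parity variable nodes. -/
inductive EccToInfo : Type
  | silent
  | node (k : ℕ) (infos : Fin k → InfoToEcc) (left right : ParityToEcc)
/-- Neighbourhood of an edge from a parity variable node to an ECC check. -/
inductive ParityToEcc : Type
  | node (bit erased : Bool) (check : EccToParity)
/-- Neighbourhood of an edge from an ECC check to a parity variable node. The check has `k`
information variable nodes and one other parity variable node. -/
inductive EccToParity : Type
  | silent
  | node (k : ℕ) (infos : Fin k → InfoToEcc) (par : ParityToEcc)
end

/-- The bit on the wire at the root of the neighbourhood. -/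
def CacToInfo.bit : CacToInfo → Bool
  | .node ω _ => ω.bit

/-- The bit on the wire at the root of the neighbourhood. -/
def InfoToEcc.bit : InfoToEcc → Bool
  | .node _ cac _ _ => cac.bit

/-- The channel output on a wire that carries the bit `b`. -/
def channelOutput (erased b : Bool) : Msg := if erased then none else some b

mutual
/-- The message that the decoder sends on the root edge of the neighbourhood. -/
def InfoToEcc.msg : InfoToEcc → Msg
  | .node e cac _ checks =>
      varUpdate (channelOutput e cac.bit) (Fin.cons cac.msg fun j => (checks j).msg)
/-- The message that the decoder sends on the root edge of the neighbourhood. -/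
def InfoToCac.msg : InfoToCac → Msg
  | .node b e _ checks => varUpdate (channelOutput e b) fun j => (checks j).msg
/-- The message that the decoder sends on the root edge of the neighbourhood. The edge to the
distinguished wire itself contributes no incoming message. -/
def CacToInfo.msg : CacToInfo → Msg
  | .node ω others =>
      cacUpdate ω.past (ω.pos.insertNth (α := fun _ => Msg) none fun j => (others j).msg) ω.pos
/-- The message that the decoder sends on the root edge of the neighbourhood. -/
def EccToInfo.msg : EccToInfo → Msg
  | .silent => none
  | .node _ infos left right =>
      eccUpdate (Fin.cons left.msg (Fin.cons right.msg fun j => (infos j).msg))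
/-- The message that the decoder sends on the root edge of the neighbourhood. -/
def ParityToEcc.msg : ParityToEcc → Msg
  | .node b e check => varUpdate (channelOutput e b) fun _ : Fin 1 => check.msg
/-- The message that the decoder sends on the root edge of the neighbourhood. -/
def EccToParity.msg : EccToParity → Msg
  | .silent => none
  | .node _ infos par => eccUpdate (Fin.cons par.msg fun j => (infos j).msg)
end

/-! ### Degree distributions -/

/-- The law on `ℕ` with probability generating polynomial `p`. -/
def polyLaw (p : ℝ[X]) (h0 : ∀ k, 0 ≤ p.coeff k) (h1 : p.eval 1 = 1) : PMF ℕ :=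
  PMF.ofFinset (fun k => ENNReal.ofReal (p.coeff k)) p.support
    (by
      rw [← ENNReal.ofReal_sum_of_nonneg fun k _ => h0 k, ← ENNReal.ofReal_one, ← h1,
        Polynomial.eval_eq_sum, Polynomial.sum]
      simp)
    (by intro k hk; simp [Polynomial.notMem_support_iff.mp hk])

/-- The edge-perspective degree distribution that belongs to a node-perspective one: the coefficient
of `x ^ k` is the probability that a random edge ends in a node of degree `k + 1`, that is, one with
`k` other edges. -/
def edgePoly (p : ℝ[X]) : ℝ[X] := C (p.derivative.eval 1)⁻¹ * p.derivative

theorem edgePoly_nonneg {p : ℝ[X]} (h0 : ∀ k, 0 ≤ p.coeff k) (hd : 0 < p.derivative.eval 1)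
    (k : ℕ) : 0 ≤ (edgePoly p).coeff k := by
  rw [edgePoly, coeff_C_mul, coeff_derivative]
  have := h0 (k + 1)
  positivity

theorem edgePoly_eval_one {p : ℝ[X]} (hd : 0 < p.derivative.eval 1) :
    (edgePoly p).eval 1 = 1 := by
  rw [edgePoly, eval_mul, eval_C, inv_mul_cancel₀ hd.ne']

/-- The parameters of the joint code ensemble: the rate of the ECC and the node-perspective degree
distributions `L` (information variable nodes) and `R` (ECC checks) of the LDPC part, matched to the
rate. -/
structure Ensemble where
  rate : ℝ
  rate_gt : 3 / 4 < rate
  rate_le : rate ≤ 1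
  L : ℝ[X]
  L_nonneg : ∀ k, 0 ≤ L.coeff k
  L_one : L.eval 1 = 1
  L_mean : 0 < L.derivative.eval 1
  R : ℝ[X]
  R_nonneg : ∀ k, 0 ≤ R.coeff k
  R_one : R.eval 1 = 1
  R_mean : 0 < R.derivative.eval 1
  design : L.derivative.eval 1 / R.derivative.eval 1 = 1 / rate - 1

/-- Edge-perspective variable degree distribution. -/
def Ensemble.lam (E : Ensemble) : ℝ[X] := edgePoly E.L

/-- Edge-perspective check degree distribution. -/
def Ensemble.rho (E : Ensemble) : ℝ[X] := edgePoly E.R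

/-- The probability that an alternating run of the information part has length `d`. -/
def runProb (rate : ℝ) (d : ℕ) : ℝ :=
  if d = 0 then 0
  else if d = 1 then (2 * rate - 3 / 2) / (2 * rate - 1)
  else (1 / 2) ^ d / (2 * rate - 1)

theorem runProb_nonneg {rate : ℝ} (h : 3 / 4 < rate) (d : ℕ) : 0 ≤ runProb rate d := by
  have h1 : 0 < 2 * rate - 1 := by linarith
  have h2 : 0 < 2 * rate - 3 / 2 := by linarith
  unfold runProb
  split_ifs <;> positivity

theorem hasSum_runProb {rate : ℝ} (h : 3 / 4 < rate) : HasSum (runProb rate) 1 := by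
  have h1 : (2 * rate - 1) ≠ 0 := by linarith
  have hg := (hasSum_geometric_two.mul_left (1 / 4)).div_const (2 * rate - 1)
  have e : (fun n => runProb rate (n + 2)) =
      fun n : ℕ => 1 / 4 * (1 / 2 : ℝ) ^ n / (2 * rate - 1) := by
    funext n
    rw [runProb, if_neg (by omega), if_neg (by omega), pow_add]
    ring
  rw [← hasSum_nat_add_iff' 2, e]
  have e2 : 1 - ∑ i ∈ Finset.range 2, runProb rate i = 1 / 4 * 2 / (2 * rate - 1) := by
    rw [Finset.sum_range_succ, Finset.sum_range_one, runProb, if_pos rfl, runProb,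
      if_neg one_ne_zero, if_pos rfl]
    field_simp
    ring
  rw [e2]
  exact hg

/-- The law of the length of a run of the information part. -/
def Ensemble.runLaw (E : Ensemble) : PMF ℕ :=
  ⟨fun d => ENNReal.ofReal (runProb E.rate d), by
    have hs := hasSum_runProb E.rate_gt
    have := ENNReal.ofReal_tsum_of_nonneg (runProb_nonneg E.rate_gt) hs.summable
    rw [hs.tsum_eq, ENNReal.ofReal_one] at this
    rw [this]
    exact ENNReal.summable.hasSum⟩

theorem Ensemble.runLaw_mean_ne_zero (E : Ensemble) :
    ∑' d : ℕ, (d : ℝ≥0∞) * E.runLaw d ≠ 0 := by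
  intro h
  have h2 := ENNReal.tsum_eq_zero.mp h 2
  have h1 : 0 < 2 * E.rate - 1 := by linarith [E.rate_gt]
  have h3 : 0 < runProb E.rate 2 := by
    rw [runProb, if_neg (by omega), if_neg (by omega)]
    positivity
  have h4 : E.runLaw 2 = ENNReal.ofReal (runProb E.rate 2) := rfl
  rw [h4] at h2
  rcases mul_eq_zero.mp h2 with h5 | h5
  · simp at h5
  · exact absurd (ENNReal.ofReal_eq_zero.mp h5) (not_le.mpr h3)

theorem Ensemble.runLaw_mean_ne_top (E : Ensemble) :
    ∑' d : ℕ, (d : ℝ≥0∞) * E.runLaw d ≠ ∞ := by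
  have hs : Summable fun d : ℕ => (d : ℝ) * runProb E.rate d := by
    have hg : Summable fun d : ℕ => (d : ℝ) * (1 / 2) ^ d :=
      (hasSum_coe_mul_geometric_of_norm_lt_one (r := (1 / 2 : ℝ)) (by norm_num)).summable
    rw [← summable_nat_add_iff 2] at hg ⊢
    refine (hg.div_const (2 * E.rate - 1)).congr fun n => ?_
    rw [runProb, if_neg (by omega), if_neg (by omega)]
    ring
  have e : ∀ d : ℕ, (d : ℝ≥0∞) * E.runLaw d = ENNReal.ofReal ((d : ℝ) * runProb E.rate d) := by
    intro d
    rw [ENNReal.ofReal_mul (Nat.cast_nonneg d), ENNReal.ofReal_natCast]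
    rfl
  simp_rw [e]
  rw [← ENNReal.ofReal_tsum_of_nonneg
    (fun d => mul_nonneg (Nat.cast_nonneg d) (runProb_nonneg E.rate_gt d)) hs]
  exact ENNReal.ofReal_ne_top

/-- The law of the length of the run of a uniformly random edge of the CAC part: the size-biased law
of the run length. -/
def Ensemble.cacEdgeLaw (E : Ensemble) : PMF ℕ :=
  PMF.normalize (fun d => (d : ℝ≥0∞) * E.runLaw d) E.runLaw_mean_ne_zero E.runLaw_mean_ne_top

/-! ### The random decoding neighbourhoods -/

/-- The joint law of independent random elements. -/
def indep {α : Type} : {n : ℕ} → (Fin n → PMF α) → PMF (Fin n → α)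
  | 0, _ => PMF.pure Fin.elim0
  | _ + 1, p => (p 0).bind fun a => (indep fun i => p i.succ).map (Fin.cons a)

/-- The erasure flag of a wire: `true` with probability `ε`. -/
def erasure (ε : unitInterval) : PMF Bool :=
  PMF.ofFintype (fun e => ENNReal.ofReal (if e then (ε : ℝ) else 1 - ε)) (by
    simp only [Fintype.sum_bool, if_true, Bool.false_eq_true, if_false]
    rw [← ENNReal.ofReal_add ε.2.1 (by linarith [ε.2.2])]
    simp)

/-- The run of a uniformly random edge of the CAC part: its length, its first past bit (fair), its
codeword (uniform among all codewords of the run) and the position of the edge (uniform). -/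
def Ensemble.run (E : Ensemble) : PMF Run :=
  (E.cacEdgeLaw.map (· - 1)).bind fun n =>
  (PMF.uniformOfFintype Bool).bind fun phase =>
  (PMF.uniformOfFinset (cacWords (altRun phase (n + 1))) (cacWords_nonempty _)).bind fun word =>
  (PMF.uniformOfFintype (Fin (n + 1))).map fun pos => ⟨n, phase, word, pos⟩

/-- The number of further ECC checks of the information variable node of a random LDPC edge. -/
def Ensemble.lamLaw (E : Ensemble) : PMF ℕ :=
  polyLaw E.lam (edgePoly_nonneg E.L_nonneg E.L_mean) (edgePoly_eval_one E.L_mean)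

/-- The number of further information variable nodes of the ECC check of a random LDPC edge. -/
def Ensemble.rhoLaw (E : Ensemble) : PMF ℕ :=
  polyLaw E.rho (edgePoly_nonneg E.R_nonneg E.R_mean) (edgePoly_eval_one E.R_mean)

/-- The number of ECC checks of a random information variable node. -/
def Ensemble.LLaw (E : Ensemble) : PMF ℕ := polyLaw E.L E.L_nonneg E.L_one

/-- The number of information variable nodes of a random ECC check. -/
def Ensemble.RLaw (E : Ensemble) : PMF ℕ := polyLaw E.R E.R_nonneg E.R_one

/-- The XOR of bits. -/
def xorSum {k : ℕ} (b : Fin k → Bool) : Bool := (List.ofFn b).foldr xor false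

section Laws

variable (E : Ensemble) (ε : unitInterval)

/-- Random edge from an information variable node with bit `b` to its CAC check, where `Y` is the law
of the neighbourhoods of incoming ECC-check edges given the bit. -/
def infoToCacLaw (Y : Bool → PMF EccToInfo) (b : Bool) : PMF InfoToCac :=
  (erasure ε).bind fun e =>
  E.LLaw.bind fun k =>
  (indep fun _ : Fin k => Y b).map fun checks => .node b e k checks

/-- Random edge from a CAC check to an information variable node. -/
def cacToInfoLaw (Y : Bool → PMF EccToInfo) : PMF CacToInfo :=
  E.run.bind fun ω =>
  (indep fun j => infoToCacLaw E ε Y (ω.word (ω.pos.succAbove j))).map fun others => .node ω others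

/-- Random edge from an information variable node to an ECC check. -/
def infoToEccLaw (Y : Bool → PMF EccToInfo) : PMF InfoToEcc :=
  (cacToInfoLaw E ε Y).bind fun cac =>
  (erasure ε).bind fun e =>
  E.lamLaw.bind fun k =>
  (indep fun _ : Fin k => Y cac.bit).map fun checks => .node e cac k checks

/-- Random edge from a parity variable node with bit `p` to an ECC check, after `s` exchanges between
ECC checks and parity variable nodes, where `X` is the law of the neighbourhoods of edges from
information variable nodes to ECC checks. The bit of the next parity variable node of the accumulate
chain is determined by the parity check in between. -/
def parityToEccLaw (X : PMF InfoToEcc) : ℕ → Bool → PMF ParityToEcc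
  | 0, p => (erasure ε).map fun e => .node p e .silent
  | s + 1, p =>
      (erasure ε).bind fun e =>
      E.RLaw.bind fun k =>
      (indep fun _ : Fin k => X).bind fun infos =>
      (parityToEccLaw X s (xor p (xorSum fun j => (infos j).bit))).map fun par =>
        .node p e (.node k infos par)

/-- Random edge from an ECC check to a parity variable node with bit `p`. -/
def eccToParityLaw (X : PMF InfoToEcc) (s : ℕ) (p : Bool) : PMF EccToParity :=
  E.RLaw.bind fun k =>
  (indep fun _ : Fin k => X).bind fun infos =>
  (parityToEccLaw E ε X s (xor p (xorSum fun j => (infos j).bit))).map fun par =>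
    .node k infos par

/-- Random edge from an ECC check to an information variable node with bit `b`, after `s` exchanges
between ECC checks and parity variable nodes. The first parity bit has law `π`, the second one is
determined by the parity check. -/
def eccToInfoLaw (π : PMF Bool) (X : PMF InfoToEcc) (s : ℕ) (b : Bool) : PMF EccToInfo :=
  E.rhoLaw.bind fun k =>
  (indep fun _ : Fin k => X).bind fun infos =>
  π.bind fun p =>
  (parityToEccLaw E ε X s p).bind fun left =>
  (parityToEccLaw E ε X s (xor b (xor p (xorSum fun j => (infos j).bit)))).map fun right =>
    .node k infos left right

/-! ### The decoding schedule

In each round messages are sent, in this order: from information variable nodes to CAC checks, from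
CAC checks to information variable nodes, from information variable nodes to ECC checks, `s` times
back and forth between ECC checks and parity variable nodes, and from ECC checks to information
variable nodes. -/

variable (π : PMF Bool)

/-- The edges from ECC checks to information variable nodes at the beginning of round `r`. -/
def roundLaw (s : ℕ) : ℕ → Bool → PMF EccToInfo
  | 0 => fun _ => PMF.pure .silent
  | r + 1 => eccToInfoLaw E ε π (infoToEccLaw E ε (roundLaw s r)) s

/-- The probability that a random message is an erasure. -/
def erasureProb (μ : PMF Msg) : ℝ := (μ none).toReal

/-- Erasure probability of the messages from information variable nodes to CAC checks in round `r`. -/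
def xCAC (s r : ℕ) : ℝ :=
  erasureProb (E.run.bind fun ω => (infoToCacLaw E ε (roundLaw E ε π s r) ω.bit).map InfoToCac.msg)

/-- Erasure probability of the messages from CAC checks to information variable nodes in round `r`. -/
def yCAC (s r : ℕ) : ℝ :=
  erasureProb ((cacToInfoLaw E ε (roundLaw E ε π s r)).map CacToInfo.msg)

/-- Erasure probability of the messages from information variable nodes to ECC checks in round `r`. -/
def xECC (s r : ℕ) : ℝ :=
  erasureProb ((infoToEccLaw E ε (roundLaw E ε π s r)).map InfoToEcc.msg)

/-- Erasure probability of the messages from ECC checks to information variable nodes at the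
beginning of round `r`. -/
def yECC (s r : ℕ) : ℝ :=
  erasureProb (E.run.bind fun ω => (roundLaw E ε π s r ω.bit).map EccToInfo.msg)

/-- Erasure probability of the messages from parity variable nodes to ECC checks in round `r`,
after `i` exchanges. -/
def xP (s r i : ℕ) : ℝ :=
  erasureProb (π.bind fun p =>
    (parityToEccLaw E ε (infoToEccLaw E ε (roundLaw E ε π s r)) i p).map ParityToEcc.msg)

/-- Erasure probability of the messages from ECC checks to parity variable nodes in round `r`,
computed from the parity messages after `i` exchanges. -/
def yP (s r i : ℕ) : ℝ :=
  erasureProb (π.bind fun p =>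
    (eccToParityLaw E ε (infoToEccLaw E ε (roundLaw E ε π s r)) i p).map EccToParity.msg)

end Laws

/-! ### The quantities of the CAC recursion -/

/-- Edge-perspective degree distribution of the CAC part, in closed form. -/
def rhoTilde (rate : ℝ) (d : ℕ) : ℝ :=
  if d = 0 then 0
  else if d = 1 then 1 - 3 / (4 * rate)
  else d * (1 / 2) ^ (d + 1) / rate

/-- Coefficient `p_{d,i}^{(1)}`, for `1 ≤ i ≤ d` and `2 ≤ d`. -/
def pOne (d i : ℕ) : ℝ :=
  if i = 1 ∨ i = d then (Nat.fib (d - 1) : ℝ) / Nat.fib (d + 2)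
  else ((Nat.fib (i - 1) : ℝ) * Nat.fib (d - i + 1) + Nat.fib i * Nat.fib (d - i)) /
    Nat.fib (d + 2)

/-- Coefficient `p_{d,i}^{(2)}`, for `1 ≤ i ≤ d` and `2 ≤ d`. -/
def pTwo (d i : ℕ) : ℝ :=
  if i = 1 ∨ i = d then 0
  else (Nat.fib (i - 1) : ℝ) * Nat.fib (d - i) / Nat.fib (d + 2)

/-- The polynomial `p_{d,i}`. -/
def pPoly (d i : ℕ) : ℝ[X] := C (pOne d i) * (1 - X) + C (pTwo d i) * (1 - X ^ 2)

end JointCAC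

end

/-!
The decoder is analysed on the random trees by following one invariant, `Erasing`: the message on a
random edge at a node that carries the bit `b` is never wrong, and it is an erasure with a
probability that does not depend on `b`. Both halves are needed together. The bits on the tree are
far from independent: the word on a run is constrained, and the second parity bit at an ECC check is
determined by the other bits there. But once the erasure probability of a message is the same for
both values of its bit, the dependence between the bits has no effect on the erasures, and erasures
and known messages multiply as for independent edges (`expect_indep_prod`). Correctness enters at
the CAC checks, where a message acts only if its value differs from the past value of the wire. For
the messages from CAC checks themselves only correctness survives, because they are known only for
bits that equal the past value; this is enough, as the variable node behind them sees the other
messages with erasure probabilities that do not depend on the bit.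

At a CAC check a wire stays unknown exactly if no neighbouring wire is known to switch. Given the
codeword, this has probability `x ^ c`, where `c` is the number of neighbours that switch
(`expect_erased_others`). The codewords of an alternating run are the words without two adjacent
switching wires, so the sum of `x ^ c` over all of them obeys a Fibonacci-like recursion
(`sum_cacWords`), whose solution gives the polynomials `p_{d,i}` (`transfer_nbrWeight`).

On the accumulate chain the parity messages satisfy an affine recursion with slope `ε q`, where
`q ≤ 1`. For `ε < 1` it contracts uniformly in `q`, so the limit may be taken although `q` itself
depends on the number of exchanges through the earlier rounds; for `ε = 1` it is constant
(`tendsto_chainRec`). The CAC recursion passes to the limit by dominated convergence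
(`exists_hasSum_cacTerm_of_tendsto`), the other equations by continuity of polynomials.
-/

namespace JointCAC

/-! ### Expectations of nonnegative functions -/

/-- The expectation of a function with values in `[0, ∞]`; no integrability is needed. -/
noncomputable def expect {α : Type} (μ : PMF α) (g : α → ℝ≥0∞) : ℝ≥0∞ := ∑' a, μ a * g a

section Expect

variable {α β : Type}

theorem expect_pure (a : α) (g : α → ℝ≥0∞) : expect (PMF.pure a) g = g a := by
  rw [expect, tsum_eq_single a]
  · simp
  · intro b hb
    simp [hb]

theorem expect_bind (μ : PMF α) (f : α → PMF β) (g : β → ℝ≥0∞) :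
    expect (μ.bind f) g = expect μ fun a => expect (f a) g := by
  simp only [expect, PMF.bind_apply, ← ENNReal.tsum_mul_right, ← ENNReal.tsum_mul_left]
  rw [ENNReal.tsum_comm]
  simp only [mul_assoc]

theorem expect_map (μ : PMF α) (f : α → β) (g : β → ℝ≥0∞) :
    expect (μ.map f) g = expect μ fun a => g (f a) := by
  simp only [PMF.map, expect_bind, Function.comp_apply, expect_pure]

theorem expect_const (μ : PMF α) (c : ℝ≥0∞) : (expect μ fun _ => c) = c := by
  rw [expect, ENNReal.tsum_mul_right, μ.tsum_coe, one_mul]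

theorem expect_add (μ : PMF α) (g h : α → ℝ≥0∞) :
    (expect μ fun a => g a + h a) = expect μ g + expect μ h := by
  simp only [expect, mul_add, ENNReal.tsum_add]

theorem expect_mul_left (μ : PMF α) (c : ℝ≥0∞) (g : α → ℝ≥0∞) :
    (expect μ fun a => c * g a) = c * expect μ g := by
  simp only [expect, ← ENNReal.tsum_mul_left, mul_left_comm c]

theorem expect_mul_right (μ : PMF α) (c : ℝ≥0∞) (g : α → ℝ≥0∞) :
    (expect μ fun a => g a * c) = expect μ g * c := by
  simp only [mul_comm _ c, expect_mul_left]

theorem expect_congr {μ : PMF α} {g h : α → ℝ≥0∞} (H : ∀ a ∈ μ.support, g a = h a) :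
    expect μ g = expect μ h := by
  refine tsum_congr fun a => ?_
  by_cases ha : μ a = 0
  · simp [ha]
  · rw [H a ((μ.mem_support_iff a).mpr ha)]

/-- Independence: the expectation of a product of functions of the components is the product of the
expectations. -/
theorem expect_indep_prod {n : ℕ} (p : Fin n → PMF α) (g : Fin n → α → ℝ≥0∞) :
    (expect (indep p) fun f => ∏ i, g i (f i)) = ∏ i, expect (p i) (g i) := by
  induction n with
  | zero => simp [indep, expect_pure]
  | succ n ih =>
    simp only [indep, expect_bind, expect_map, Fin.prod_univ_succ, Fin.cons_zero, Fin.cons_succ,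
      expect_mul_left, ih (fun i => p i.succ) fun i => g i.succ, expect_mul_right]

theorem mem_support_indep {n : ℕ} {p : Fin n → PMF α} {f : Fin n → α}
    (hf : f ∈ (indep p).support) (i : Fin n) : f i ∈ (p i).support := by
  induction n with
  | zero => exact i.elim0
  | succ n ih =>
    simp only [indep, PMF.mem_support_bind_iff, PMF.mem_support_map_iff] at hf
    obtain ⟨a, ha, f', hf', rfl⟩ := hf
    refine Fin.cases ?_ (fun j => ?_) i
    · simpa using ha
    · simpa using ih hf' j

theorem expect_uniformOfFinset (s : Finset α) (hs : s.Nonempty) (g : α → ℝ≥0∞) :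
    expect (PMF.uniformOfFinset s hs) g = (s.card : ℝ≥0∞)⁻¹ * ∑ a ∈ s, g a := by
  rw [expect, tsum_eq_sum (s := s), Finset.mul_sum]
  · exact Finset.sum_congr rfl fun a ha => by rw [PMF.uniformOfFinset_apply_of_mem hs ha]
  · intro a ha
    rw [PMF.uniformOfFinset_apply_of_notMem hs ha, zero_mul]

theorem expect_uniformOfFintype [Fintype α] [Nonempty α] (g : α → ℝ≥0∞) :
    expect (PMF.uniformOfFintype α) g = (Fintype.card α : ℝ≥0∞)⁻¹ * ∑ a, g a :=
  expect_uniformOfFinset _ _ g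

theorem expect_polyLaw (p : ℝ[X]) (h0 : ∀ k, 0 ≤ p.coeff k) (h1 : p.eval 1 = 1) {x : ℝ}
    (hx : 0 ≤ x) :
    (expect (polyLaw p h0 h1) fun k => ENNReal.ofReal x ^ k) = ENNReal.ofReal (p.eval x) := by
  rw [Polynomial.eval_eq_sum, Polynomial.sum,
    ENNReal.ofReal_sum_of_nonneg fun k _ => mul_nonneg (h0 k) (pow_nonneg hx k), expect,
    tsum_eq_sum (s := p.support)]
  · refine Finset.sum_congr rfl fun k _ => ?_
    rw [ENNReal.ofReal_mul (h0 k), ENNReal.ofReal_pow hx]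
    rfl
  · intro k hk
    rw [polyLaw, PMF.ofFinset_apply_of_notMem _ _ hk, zero_mul]

end Expect

/-! ### Erased and known messages -/

/-- The indicator of an erasure. -/
noncomputable def erased (m : Msg) : ℝ≥0∞ := if m = none then 1 else 0

/-- The indicator of a message that is not an erasure. -/
noncomputable def known (m : Msg) : ℝ≥0∞ := if m = none then 0 else 1

/-- A message about the bit `b` is correct if it is an erasure or has the value `b`. -/
def Correct (b : Bool) (m : Msg) : Prop := ∀ v, m = some v → v = b

theorem erased_add_known (m : Msg) : erased m + known m = 1 := by
  unfold erased known
  split_ifs <;> simp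

theorem erasureProb_eq {α : Type} (μ : PMF α) (f : α → Msg) :
    erasureProb (μ.map f) = (expect μ fun a => erased (f a)).toReal := by
  rw [erasureProb, PMF.map_apply, expect]
  congr 1
  refine tsum_congr fun a => ?_
  by_cases h : f a = none <;> simp [erased, h, eq_comm]

/-- The probability of an erasure is a number `x ∈ [0, 1]`, and then that of a known message is
`1 - x`. -/
theorem expect_known {α : Type} {μ : PMF α} {f : α → Msg} {x : ℝ} (hx : 0 ≤ x)
    (h : (expect μ fun a => erased (f a)) = ENNReal.ofReal x) :
    (expect μ fun a => known (f a)) = ENNReal.ofReal (1 - x) := by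
  have h1 : ENNReal.ofReal x + (expect μ fun a => known (f a)) = 1 := by
    rw [← h, ← expect_add]
    simp only [erased_add_known, expect_const]
  rw [ENNReal.ofReal_sub _ hx, ENNReal.ofReal_one]
  exact ENNReal.eq_sub_of_add_eq' (by simp) (by rwa [add_comm])

theorem expect_erased_of_known {α : Type} {μ : PMF α} {f : α → Msg} {x : ℝ} (hx : 0 ≤ x)
    (h : (expect μ fun a => known (f a)) = ENNReal.ofReal x) :
    (expect μ fun a => erased (f a)) = ENNReal.ofReal (1 - x) := by
  have h1 : ENNReal.ofReal x + (expect μ fun a => erased (f a)) = 1 := by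
    rw [← h, ← expect_add]
    simp only [add_comm (known _), erased_add_known, expect_const]
  rw [ENNReal.ofReal_sub _ hx, ENNReal.ofReal_one]
  exact ENNReal.eq_sub_of_add_eq' (by simp) (by rwa [add_comm])

theorem expect_erased_le_one {α : Type} (μ : PMF α) (f : α → Msg) :
    (expect μ fun a => erased (f a)) ≤ 1 := by
  refine le_of_le_of_eq ?_ (expect_const μ 1)
  refine ENNReal.tsum_le_tsum fun a => mul_le_mul_right ?_ _
  exact le_of_le_of_eq le_self_add (erased_add_known (f a))

theorem varUpdate_eq_none {c : Msg} {k : ℕ} {m : Fin k → Msg} :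
    varUpdate c m = none ↔ c = none ∧ ∀ j, m j = none := by
  simp [varUpdate, List.findSome?_eq_none_iff, List.mem_ofFn]

theorem Correct.varUpdate {b : Bool} {c : Msg} {k : ℕ} {m : Fin k → Msg} (hc : Correct b c)
    (hm : ∀ j, Correct b (m j)) : Correct b (varUpdate c m) := by
  intro v hv
  obtain ⟨x, hx, hxv⟩ := List.exists_of_findSome?_eq_some hv
  simp only [List.mem_cons, List.mem_ofFn, id] at hx hxv
  rcases hx with rfl | ⟨j, rfl⟩
  · exact hc v hxv
  · exact hm j v hxv

theorem erased_varUpdate (c : Msg) {k : ℕ} (m : Fin k → Msg) :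
    erased (varUpdate c m) = erased c * ∏ j, erased (m j) := by
  by_cases h : varUpdate c m = none
  · obtain ⟨h1, h2⟩ := varUpdate_eq_none.mp h
    rw [h]
    simp [erased, h1, h2]
  · rw [erased, if_neg h]
    rw [varUpdate_eq_none, not_and_or, not_forall] at h
    rcases h with h | ⟨j, h⟩
    · simp [erased, h]
    · rw [Finset.prod_eq_zero (Finset.mem_univ j) (by simp [erased, h]), mul_zero]

theorem eccUpdate_cons {k : ℕ} (x : Msg) (m : Fin k → Msg) :
    eccUpdate (Fin.cons x m : Fin (k + 1) → Msg) = Option.map₂ xor x (eccUpdate m) := by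
  simp [eccUpdate, List.ofFn_succ]

theorem known_map₂ (x y : Msg) : known (Option.map₂ xor x y) = known x * known y := by
  cases x <;> cases y <;> simp [known]

theorem known_eccUpdate {k : ℕ} (m : Fin k → Msg) : known (eccUpdate m) = ∏ j, known (m j) := by
  induction k with
  | zero => simp [eccUpdate, known]
  | succ k ih =>
    rw [← Fin.cons_self_tail m, eccUpdate_cons, known_map₂, ih, Fin.prod_univ_succ]
    simp

theorem Correct.map₂_xor {b c : Bool} {x y : Msg} (hx : Correct b x) (hy : Correct c y) :
    Correct (xor b c) (Option.map₂ xor x y) := by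
  rintro v hv
  obtain ⟨u, w, hu, hw, rfl⟩ := Option.map₂_eq_some_iff.mp hv
  rw [hx u hu, hy w hw]

theorem Correct.eccUpdate {k : ℕ} {b : Fin k → Bool} {m : Fin k → Msg}
    (h : ∀ j, Correct (b j) (m j)) : Correct (xorSum b) (eccUpdate m) := by
  induction k with
  | zero => intro v hv; simpa [JointCAC.eccUpdate, xorSum] using hv.symm
  | succ k ih =>
    have hb : xorSum b = xor (b 0) (xorSum fun j => b j.succ) := by simp [xorSum, List.ofFn_succ]
    rw [hb, ← Fin.cons_self_tail m, eccUpdate_cons]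
    exact (h 0).map₂_xor (ih fun j => h j.succ)

theorem correct_none (b : Bool) : Correct b none := by simp [Correct]

theorem correct_channelOutput (e b : Bool) : Correct b (channelOutput e b) := by
  intro v hv
  cases e <;> simp_all [channelOutput]

theorem expect_erasure (ε : unitInterval) (b : Bool) :
    (expect (erasure ε) fun e => erased (channelOutput e b)) = ENNReal.ofReal ε := by
  rw [expect, tsum_fintype]
  simp [erasure, erased, channelOutput]

/-! ### Messages on random neighbourhoods -/

/-- The invariant of density evolution: the message on a random edge at a node with bit `b` is never
wrong, and it is an erasure with a probability `y` that does not depend on `b`. -/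
structure Erasing {α : Type} (msg : α → Msg) (Y : Bool → PMF α) (y : ℝ) : Prop where
  nonneg : 0 ≤ y
  erased_eq : ∀ b, (expect (Y b) fun t => erased (msg t)) = ENNReal.ofReal y
  correct : ∀ b, ∀ t ∈ (Y b).support, Correct b (msg t)

theorem Erasing.le_one {α : Type} {msg : α → Msg} {Y : Bool → PMF α} {y : ℝ}
    (h : Erasing msg Y y) : y ≤ 1 := by
  have := expect_erased_le_one (Y true) msg
  rwa [h.erased_eq, ENNReal.ofReal_le_one] at this

/-- The erasure probability of an edge at a node with random bit is the common value `y`. -/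
theorem Erasing.erasureProb_bind {α β : Type} {msg : α → Msg} {Y : Bool → PMF α} {y : ℝ}
    (h : Erasing msg Y y) (μ : PMF β) (bit : β → Bool) :
    erasureProb (μ.bind fun ω => (Y (bit ω)).map msg) = y := by
  rw [← PMF.map_bind, erasureProb_eq, expect_bind]
  simp only [h.erased_eq, expect_const, ENNReal.toReal_ofReal h.nonneg]

theorem erasing_silent : Erasing EccToInfo.msg (fun _ => PMF.pure .silent) 1 where
  nonneg := zero_le_one
  erased_eq b := by simp [expect_pure, EccToInfo.msg, erased]
  correct b t ht := by
    rw [PMF.mem_support_pure_iff] at ht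
    subst ht
    exact correct_none b

section Laws

variable (E : Ensemble) (ε : unitInterval)

theorem eval_nonneg {p : ℝ[X]} (h0 : ∀ k, 0 ≤ p.coeff k) {x : ℝ} (hx : 0 ≤ x) : 0 ≤ p.eval x := by
  rw [Polynomial.eval_eq_sum, Polynomial.sum]
  exact Finset.sum_nonneg fun k _ => mul_nonneg (h0 k) (pow_nonneg hx k)

theorem erasing_infoToCac {Y : Bool → PMF EccToInfo} {y : ℝ} (hY : Erasing EccToInfo.msg Y y) :
    Erasing InfoToCac.msg (infoToCacLaw E ε Y) (ε * E.L.eval y) where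
  nonneg := mul_nonneg ε.2.1 (eval_nonneg E.L_nonneg hY.nonneg)
  erased_eq b := by
    simp only [infoToCacLaw, expect_bind, expect_map, InfoToCac.msg, erased_varUpdate,
      expect_mul_left]
    simp only [expect_indep_prod (fun _ => Y b) fun _ t => erased t.msg, hY.erased_eq,
      Finset.prod_const, Finset.card_univ, Fintype.card_fin, expect_mul_right, expect_erasure,
      Ensemble.LLaw, expect_polyLaw _ _ _ hY.nonneg, ENNReal.ofReal_mul ε.2.1]
  correct b t ht := by
    simp only [infoToCacLaw, PMF.mem_support_bind_iff, PMF.mem_support_map_iff] at ht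
    obtain ⟨e, -, k, -, c, hc, rfl⟩ := ht
    rw [InfoToCac.msg]
    exact (correct_channelOutput e b).varUpdate fun j => hY.correct b _ (mem_support_indep hc j)

theorem expect_lamLaw {x : ℝ} (hx : 0 ≤ x) :
    (expect E.lamLaw fun k => ENNReal.ofReal x ^ k) = ENNReal.ofReal (E.lam.eval x) :=
  expect_polyLaw _ _ _ hx

theorem expect_rhoLaw {x : ℝ} (hx : 0 ≤ x) :
    (expect E.rhoLaw fun k => ENNReal.ofReal x ^ k) = ENNReal.ofReal (E.rho.eval x) :=
  expect_polyLaw _ _ _ hx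

/-- The messages to the ECC checks are independent of the erasure on the wire and of the messages
from the other ECC checks, although the message of the CAC check depends on the bit. -/
theorem expect_erased_infoToEcc {Y : Bool → PMF EccToInfo} {y : ℝ}
    (hY : Erasing EccToInfo.msg Y y) :
    (expect (infoToEccLaw E ε Y) fun t => erased t.msg) =
      (expect (cacToInfoLaw E ε Y) fun t => erased t.msg) *
        ENNReal.ofReal (ε * E.lam.eval y) := by
  simp only [infoToEccLaw, expect_bind, expect_map, InfoToEcc.msg, erased_varUpdate,
    expect_mul_left, Fin.prod_univ_succ, Fin.cons_zero, Fin.cons_succ]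
  have h (b : Bool) (k : ℕ) : (expect (indep fun _ : Fin k => Y b) fun f => ∏ j, erased (f j).msg) =
      ENNReal.ofReal y ^ k := by
    simp [expect_indep_prod (fun _ => Y b) fun _ t => erased t.msg, hY.erased_eq]
  simp only [h, expect_mul_left, expect_mul_right, expect_erasure,
    expect_lamLaw E hY.nonneg, ENNReal.ofReal_mul ε.2.1]
  simp only [mul_left_comm]

theorem correct_infoToEcc {Y : Bool → PMF EccToInfo} {y : ℝ} (hY : Erasing EccToInfo.msg Y y)
    (hC : ∀ t ∈ (cacToInfoLaw E ε Y).support, Correct t.bit t.msg) :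
    ∀ t ∈ (infoToEccLaw E ε Y).support, Correct t.bit t.msg := by
  intro t ht
  simp only [infoToEccLaw, PMF.mem_support_bind_iff, PMF.mem_support_map_iff] at ht
  obtain ⟨c, hc, e, -, k, -, f, hf, rfl⟩ := ht
  rw [InfoToEcc.msg]
  refine (correct_channelOutput e _).varUpdate fun j => ?_
  refine Fin.cases ?_ (fun j => ?_) j
  · exact hC c hc
  · exact hY.correct _ _ (mem_support_indep hf j)

variable {X : PMF InfoToEcc} {x : ℝ}

theorem expect_prod_known {k : ℕ}
    (hk : (expect X fun t => known t.msg) = ENNReal.ofReal (1 - x)) :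
    (expect (indep fun _ : Fin k => X) fun f => ∏ j, known (f j).msg) =
      ENNReal.ofReal (1 - x) ^ k := by
  simp [expect_indep_prod (fun _ => X) fun _ t => known t.msg, hk]

theorem expect_known_eccToParity (hx1 : x ≤ 1)
    (hk : (expect X fun t => known t.msg) = ENNReal.ofReal (1 - x)) {z : ℝ} {s : ℕ}
    (hP : Erasing ParityToEcc.msg (parityToEccLaw E ε X s) z) (p : Bool) :
    (expect (eccToParityLaw E ε X s p) fun t => known t.msg) =
      ENNReal.ofReal ((1 - z) * E.R.eval (1 - x)) := by
  simp only [eccToParityLaw, expect_bind, expect_map, EccToParity.msg, known_eccUpdate,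
    Fin.prod_univ_succ, Fin.cons_zero, Fin.cons_succ, expect_mul_right,
    expect_known hP.nonneg (hP.erased_eq _), expect_mul_left, expect_prod_known hk, Ensemble.RLaw,
    expect_polyLaw _ _ _ (sub_nonneg.mpr hx1)]
  rw [ENNReal.ofReal_mul (by linarith [hP.le_one])]

theorem erasing_eccToParity (hx1 : x ≤ 1)
    (hk : (expect X fun t => known t.msg) = ENNReal.ofReal (1 - x))
    (hX : ∀ t ∈ X.support, Correct t.bit t.msg) {z : ℝ}
    {s : ℕ} (hP : Erasing ParityToEcc.msg (parityToEccLaw E ε X s) z) :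
    Erasing EccToParity.msg (eccToParityLaw E ε X s) (1 - (1 - z) * E.R.eval (1 - x)) := by
  have hq : 0 ≤ (1 - z) * E.R.eval (1 - x) :=
    mul_nonneg (by linarith [hP.le_one]) (eval_nonneg E.R_nonneg (by linarith))
  have hkn := expect_known_eccToParity E ε hx1 hk hP
  refine ⟨?_, fun p => expect_erased_of_known hq (hkn p), fun p t ht => ?_⟩
  · have h := expect_erased_of_known hq (hkn true)
    have h2 : ENNReal.ofReal ((1 - z) * E.R.eval (1 - x)) ≤ 1 := by
      rw [← hkn true, ← expect_const (eccToParityLaw E ε X s true) 1]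
      exact ENNReal.tsum_le_tsum fun a => mul_le_mul_right
        (le_of_le_of_eq le_add_self (erased_add_known _)) _
    rw [ENNReal.ofReal_le_one] at h2
    linarith
  · simp only [eccToParityLaw, PMF.mem_support_bind_iff, PMF.mem_support_map_iff] at ht
    obtain ⟨k, -, f, hf, u, hu, rfl⟩ := ht
    rw [EccToParity.msg, eccUpdate_cons]
    have h := (hP.correct _ u hu).map₂_xor
      (Correct.eccUpdate fun j => hX _ (mem_support_indep hf j))
    simpa using h

theorem parityToEccLaw_succ (s : ℕ) (p : Bool) :
    parityToEccLaw E ε X (s + 1) p =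
      (erasure ε).bind fun e => (eccToParityLaw E ε X s p).map fun c => .node p e c := by
  simp [parityToEccLaw, eccToParityLaw, PMF.map_bind, PMF.map_comp, Function.comp_def]

theorem erasing_parityToEcc_zero : Erasing ParityToEcc.msg (parityToEccLaw E ε X 0) ε where
  nonneg := ε.2.1
  erased_eq p := by
    simp only [parityToEccLaw, expect_map, ParityToEcc.msg, EccToParity.msg, erased_varUpdate,
      Finset.univ_unique, Finset.prod_singleton]
    rw [expect_mul_right, expect_erasure]
    simp [erased]
  correct p t ht := by
    simp only [parityToEccLaw, PMF.mem_support_map_iff] at ht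
    obtain ⟨e, -, rfl⟩ := ht
    rw [ParityToEcc.msg]
    exact (correct_channelOutput e p).varUpdate fun _ => by
      rw [EccToParity.msg]; exact correct_none p

theorem erasing_parityToEcc_succ {s : ℕ} {z : ℝ}
    (hP : Erasing EccToParity.msg (eccToParityLaw E ε X s) z) :
    Erasing ParityToEcc.msg (parityToEccLaw E ε X (s + 1)) (ε * z) where
  nonneg := mul_nonneg ε.2.1 hP.nonneg
  erased_eq p := by
    simp only [parityToEccLaw_succ, expect_bind, expect_map, ParityToEcc.msg, erased_varUpdate,
      Finset.univ_unique, Finset.prod_singleton, expect_mul_left, hP.erased_eq, expect_mul_right,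
      expect_erasure, ENNReal.ofReal_mul ε.2.1]
  correct p t ht := by
    simp only [parityToEccLaw_succ, PMF.mem_support_bind_iff, PMF.mem_support_map_iff] at ht
    obtain ⟨e, -, c, hc, rfl⟩ := ht
    rw [ParityToEcc.msg]
    exact (correct_channelOutput e p).varUpdate fun _ => hP.correct p c hc

/-- The recursion on the accumulate chain, for messages from information variable nodes that are
known with probability `q`. -/
noncomputable def chainRec (e q : ℝ) : ℕ → ℝ
  | 0 => e
  | s + 1 => e * (1 - (1 - chainRec e q s) * q)

theorem erasing_parityToEcc (hx1 : x ≤ 1)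
    (hk : (expect X fun t => known t.msg) = ENNReal.ofReal (1 - x))
    (hX : ∀ t ∈ X.support, Correct t.bit t.msg) (s : ℕ) :
    Erasing ParityToEcc.msg (parityToEccLaw E ε X s) (chainRec ε (E.R.eval (1 - x)) s) := by
  induction s with
  | zero => exact erasing_parityToEcc_zero E ε
  | succ s ih => exact erasing_parityToEcc_succ E ε (erasing_eccToParity E ε hx1 hk hX ih)

/-- The second parity bit at an ECC check depends on the other bits there, but the erasure
probability of its message does not; so the messages are known independently of each other. -/
theorem erasing_eccToInfo (hx1 : x ≤ 1)
    (hk : (expect X fun t => known t.msg) = ENNReal.ofReal (1 - x))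
    (hX : ∀ t ∈ X.support, Correct t.bit t.msg) {z : ℝ} {s : ℕ}
    (hP : Erasing ParityToEcc.msg (parityToEccLaw E ε X s) z) (π : PMF Bool) :
    Erasing EccToInfo.msg (eccToInfoLaw E ε π X s) (1 - (1 - z) ^ 2 * E.rho.eval (1 - x)) := by
  have hz : 0 ≤ 1 - z := by linarith [hP.le_one]
  have hq : 0 ≤ (1 - z) ^ 2 * E.rho.eval (1 - x) :=
    mul_nonneg (sq_nonneg _) (eval_nonneg (edgePoly_nonneg E.R_nonneg E.R_mean) (by linarith))
  have hkn (b : Bool) : (expect (eccToInfoLaw E ε π X s b) fun t => known t.msg) =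
      ENNReal.ofReal ((1 - z) ^ 2 * E.rho.eval (1 - x)) := by
    simp only [eccToInfoLaw, expect_bind, expect_map, EccToInfo.msg, known_eccUpdate,
      Fin.prod_univ_succ, Fin.cons_zero, Fin.cons_succ, expect_mul_right,
      expect_known hP.nonneg (hP.erased_eq _), expect_mul_left, expect_const,
      expect_prod_known hk, expect_rhoLaw E (sub_nonneg.mpr hx1)]
    rw [ENNReal.ofReal_mul (sq_nonneg _), ENNReal.ofReal_pow hz, sq, mul_assoc]
  refine ⟨?_, fun p => expect_erased_of_known hq (hkn p), fun b t ht => ?_⟩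
  · have h2 : ENNReal.ofReal ((1 - z) ^ 2 * E.rho.eval (1 - x)) ≤ 1 := by
      rw [← hkn true, ← expect_const (eccToInfoLaw E ε π X s true) 1]
      exact ENNReal.tsum_le_tsum fun a => mul_le_mul_right
        (le_of_le_of_eq le_add_self (erased_add_known _)) _
    rw [ENNReal.ofReal_le_one] at h2
    linarith
  · simp only [eccToInfoLaw, PMF.mem_support_bind_iff, PMF.mem_support_map_iff] at ht
    obtain ⟨k, -, f, hf, p, -, u, hu, v, hv, rfl⟩ := ht
    rw [EccToInfo.msg, eccUpdate_cons, eccUpdate_cons]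
    have h := (hP.correct _ u hu).map₂_xor ((hP.correct _ v hv).map₂_xor
      (Correct.eccUpdate fun j => hX _ (mem_support_indep hf j)))
    have e : ∀ b p x : Bool, xor p (xor (xor b (xor p x)) x) = b := by decide
    rwa [e] at h

end Laws

/-! ### Counting codewords of an alternating run -/

theorem altRun_ne_of_adjacent (φ : Bool) {d : ℕ} {i j : Fin d} (h : j.val = i.val + 1) :
    altRun φ d i ≠ altRun φ d j := by
  unfold altRun
  rcases Nat.mod_two_eq_zero_or_one i.val with h1 | h1
  · rw [if_pos h1, if_neg (by omega)]
    simp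
  · rw [if_neg (by omega), if_pos (by omega)]
    simp

theorem altRun_castSucc (φ : Bool) (n : ℕ) (i : Fin n) :
    altRun φ (n + 1) i.castSucc = altRun φ n i := rfl

/-- On an alternating run the codewords are the words in which no two adjacent wires switch. -/
theorem isCACWord_altRun {φ : Bool} {d : ℕ} {w : Fin d → Bool} :
    IsCACWord (altRun φ d) w ↔
      ∀ i j : Fin d, j.val = i.val + 1 → ¬ (w i ≠ altRun φ d i ∧ w j ≠ altRun φ d j) := by
  refine forall₂_congr fun i j => forall_congr' fun h => not_congr ?_
  have := altRun_ne_of_adjacent φ h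
  simp [Opposing, this, eq_comm]

theorem isCACWord_snoc {φ : Bool} {n : ℕ} {w : Fin n → Bool} {v : Bool} :
    IsCACWord (altRun φ (n + 1)) (Fin.snoc w v : Fin (n + 1) → Bool) ↔
      IsCACWord (altRun φ n) w ∧
        ∀ i : Fin n, n = i.val + 1 →
          ¬ (w i ≠ altRun φ n i ∧ v ≠ altRun φ (n + 1) (Fin.last n)) := by
  simp only [isCACWord_altRun, Fin.forall_fin_succ', Fin.snoc_castSucc, Fin.snoc_last,
    altRun_castSucc, Fin.val_castSucc, Fin.val_last]
  refine ⟨fun h => ⟨fun i => (h.1 i).1, fun i => (h.1 i).2⟩,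
    fun h => ⟨fun i => ⟨h.1 i, h.2 i⟩, fun i hi => ?_, fun hi => ?_⟩⟩
  · exact absurd hi (by have := i.2; omega)
  · omega

section Count

variable {S : Type} [CommSemiring S]

/-- The transfer recursion for the weighted number of binary words of length `n` without two
adjacent ones, where a one in position `j` has weight `f j`. -/
def transfer (f : ℕ → S) : ℕ → S
  | 0 => 1
  | 1 => 1 + f 0
  | n + 2 => transfer f (n + 1) + f (n + 1) * transfer f n

open Classical in
/-- The weight of a word on an alternating run: the product of the weights of the switching wires
for a codeword, and zero for other words. -/
noncomputable def wordWeight (φ : Bool) (f : ℕ → S) (n : ℕ) (w : Fin n → Bool) : S :=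
  if IsCACWord (altRun φ n) w then ∏ j, (if w j ≠ altRun φ n j then f j else 1) else 0

theorem wordWeight_snoc_keep (φ : Bool) (f : ℕ → S) (n : ℕ) (w : Fin n → Bool) :
    wordWeight φ f (n + 1) (Fin.snoc w (altRun φ (n + 1) (Fin.last n)) : Fin (n + 1) → Bool) =
      wordWeight φ f n w := by
  have h : IsCACWord (altRun φ (n + 1))
      (Fin.snoc w (altRun φ (n + 1) (Fin.last n)) : Fin (n + 1) → Bool) ↔
      IsCACWord (altRun φ n) w := by
    rw [isCACWord_snoc]
    exact and_iff_left fun i _ hi => hi.2 rfl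
  by_cases hw : IsCACWord (altRun φ n) w
  · rw [wordWeight, wordWeight, if_pos hw, if_pos (h.mpr hw)]
    simp [Fin.prod_univ_castSucc, altRun_castSucc]
  · rw [wordWeight, wordWeight, if_neg hw, if_neg (mt h.mp hw)]

theorem wordWeight_snoc_switch (φ : Bool) (f : ℕ → S) (n : ℕ) (w : Fin n → Bool)
    (h : ∀ i : Fin n, n = i.val + 1 → w i = altRun φ n i) :
    wordWeight φ f (n + 1) (Fin.snoc w (!altRun φ (n + 1) (Fin.last n)) : Fin (n + 1) → Bool) =
      f n * wordWeight φ f n w := by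
  have h' : ∀ i : Fin n, n = i.val + 1 →
      ¬ (w i ≠ altRun φ n i ∧ (!altRun φ (n + 1) (Fin.last n)) ≠ altRun φ (n + 1) (Fin.last n)) :=
    fun i hi hw => hw.1 (h i hi)
  by_cases hc : IsCACWord (altRun φ n) w
  · simp only [wordWeight, isCACWord_snoc, hc, true_and, if_pos h', if_true,
      Fin.prod_univ_castSucc, altRun_castSucc, Fin.snoc_castSucc, Fin.snoc_last, Fin.val_castSucc,
      Fin.val_last]
    simp [mul_comm]
  · simp [wordWeight, isCACWord_snoc, hc]

theorem wordWeight_snoc_eq_zero (φ : Bool) (f : ℕ → S) (n : ℕ) (w : Fin n → Bool)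
    (i : Fin n) (hi : n = i.val + 1) (h : w i ≠ altRun φ n i) :
    wordWeight φ f (n + 1) (Fin.snoc w (!altRun φ (n + 1) (Fin.last n)) : Fin (n + 1) → Bool) =
      0 := by
  rw [wordWeight, if_neg]
  rw [isCACWord_snoc]
  exact fun hc => hc.2 i hi ⟨h, by simp⟩

theorem sum_snoc {n : ℕ} (a : Bool) (F : (Fin (n + 1) → Bool) → S) :
    ∑ w, F w = ∑ w : Fin n → Bool, F (Fin.snoc w a) + ∑ w : Fin n → Bool, F (Fin.snoc w (!a)) := by
  rw [← (Fin.snocEquiv fun _ : Fin (n + 1) => Bool).sum_comp, Fintype.sum_prod_type,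
    Fintype.sum_bool]
  cases a
  · rw [add_comm]; rfl
  · rfl

/-- The recursion comes from the last wire: if it keeps its value, the rest is any codeword, and if
it switches, then the wire before it keeps its value. -/
theorem sum_wordWeight (φ : Bool) (f : ℕ → S) (n : ℕ) :
    ∑ w, wordWeight φ f n w = transfer f n := by
  induction n using Nat.twoStepInduction with
  | zero => simp [transfer, wordWeight, IsCACWord]
  | one =>
    rw [sum_snoc (altRun φ 1 (Fin.last 0))]
    simp only [wordWeight_snoc_keep]
    rw [Finset.sum_congr rfl fun w _ => wordWeight_snoc_switch φ f 0 w fun i => i.elim0]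
    simp [transfer, wordWeight, IsCACWord]
  | more n ih0 ih1 =>
    rw [sum_snoc (altRun φ (n + 2) (Fin.last (n + 1)))]
    simp only [wordWeight_snoc_keep]
    rw [ih1, sum_snoc (altRun φ (n + 1) (Fin.last n))]
    rw [Finset.sum_congr rfl fun w _ => wordWeight_snoc_switch φ f (n + 1)
      (Fin.snoc w (altRun φ (n + 1) (Fin.last n)) : Fin (n + 1) → Bool) fun i hi => by
        obtain rfl : i = Fin.last n := Fin.ext (by rw [Fin.val_last]; omega)
        simp]
    rw [Finset.sum_congr rfl fun w _ => wordWeight_snoc_eq_zero φ f (n + 1)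
      (Fin.snoc w (!altRun φ (n + 1) (Fin.last n)) : Fin (n + 1) → Bool) (Fin.last n)
        (by simp) (by simp)]
    simp only [wordWeight_snoc_keep, ← Finset.mul_sum, ih0, Finset.sum_const_zero, add_zero]
    rw [transfer]

theorem sum_cacWords (φ : Bool) (f : ℕ → S) (n : ℕ) :
    ∑ w ∈ cacWords (altRun φ n), ∏ j, (if w j ≠ altRun φ n j then f j else 1) = transfer f n := by
  rw [← sum_wordWeight φ, cacWords, Finset.sum_filter]
  rfl

theorem transfer_eq_fib {f : ℕ → S} {n : ℕ} (h : ∀ j < n, f j = 1) :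
    transfer f n = (Nat.fib (n + 2) : S) := by
  induction n using Nat.twoStepInduction with
  | zero => simp [transfer]
  | one =>
    have h3 : Nat.fib 3 = 2 := rfl
    rw [transfer, h 0 one_pos, h3]
    norm_num
  | more n ih0 ih1 =>
    rw [transfer, ih0 fun j hj => h j (by omega), ih1 fun j hj => h j (by omega),
      h _ (by omega), one_mul, Nat.fib_add_two (n := n + 2)]
    push_cast
    rw [add_comm]

theorem card_cacWords (φ : Bool) (n : ℕ) : (cacWords (altRun φ n)).card = Nat.fib (n + 2) := by
  have h := sum_cacWords (S := ℕ) φ (fun _ => 1) n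
  rw [transfer_eq_fib fun _ _ => rfl] at h
  simpa using h

/-- Once all remaining weights are `1`, the recursion is that of the Fibonacci numbers. -/
theorem transfer_add {f : ℕ → S} {k : ℕ} (h : ∀ j, k < j → f j = 1) (m : ℕ) :
    transfer f (k + 1 + m) =
      (Nat.fib (m + 1) : S) * transfer f (k + 1) + (Nat.fib m : S) * transfer f k := by
  induction m using Nat.twoStepInduction with
  | zero => simp
  | one =>
    rw [transfer, h _ (Nat.lt_succ_self k)]
    simp
  | more m ih0 ih1 =>
    rw [show k + 1 + (m + 2) = (k + 1 + m) + 2 by omega, transfer, ih0,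
      show k + 1 + m + 1 = k + 1 + (m + 1) by omega, ih1, h _ (by omega),
      Nat.fib_add_two (n := m + 1), Nat.fib_add_two (n := m)]
    push_cast
    ring

/-- The weight `x` on the two neighbours of position `i`, and `1` elsewhere. -/
def nbrWeight (x : S) (i j : ℕ) : S := if j + 1 = i ∨ j = i + 1 then x else 1

theorem nbrWeight_eq_one {x : S} {i j : ℕ} (h : ¬ (j + 1 = i ∨ j = i + 1)) :
    nbrWeight x i j = 1 := if_neg h

theorem transfer_ofReal {f : ℕ → ℝ} (h : ∀ j, 0 ≤ f j) (n : ℕ) :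
    0 ≤ transfer f n ∧
      transfer (fun j => ENNReal.ofReal (f j)) n = ENNReal.ofReal (transfer f n) := by
  induction n using Nat.twoStepInduction with
  | zero => simp [transfer]
  | one =>
    refine ⟨add_nonneg zero_le_one (h 0), ?_⟩
    rw [transfer, transfer, ENNReal.ofReal_add zero_le_one (h 0), ENNReal.ofReal_one]
  | more n ih0 ih1 =>
    refine ⟨add_nonneg ih1.1 (mul_nonneg (h _) ih0.1), ?_⟩
    rw [transfer, transfer, ENNReal.ofReal_add ih1.1 (mul_nonneg (h _) ih0.1),
      ENNReal.ofReal_mul (h _), ih0.2, ih1.2]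

end Count

theorem transfer_le_fib {f : ℕ → ℝ} (h0 : ∀ j, 0 ≤ f j) (h1 : ∀ j, f j ≤ 1) (n : ℕ) :
    transfer f n ≤ Nat.fib (n + 2) := by
  induction n using Nat.twoStepInduction with
  | zero => simp [transfer]
  | one =>
    have h3 : Nat.fib 3 = 2 := rfl
    rw [transfer, h3]
    push_cast
    linarith [h1 0]
  | more n ih0 ih1 =>
    have h := mul_le_of_le_one_left (transfer_ofReal h0 n).1 (h1 (n + 1))
    rw [transfer, Nat.fib_add_two (n := n + 2)]
    push_cast
    linarith

/-- The generating polynomial of the number of neighbours of wire `p + 1` that switch, over all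
codewords of a run of length `d`. A codeword with `c` switching neighbours leaves the wire unknown
with probability `x ^ c`, which gives the polynomials `p_{d,i}`. -/
theorem transfer_nbrWeight (x : ℝ) {d p : ℕ} (hd : 2 ≤ d) (hp : p < d) :
    transfer (nbrWeight x p) d = Nat.fib (d + 2) * (1 - (pPoly d (p + 1)).eval x) := by
  have hf : (Nat.fib (d + 2) : ℝ) ≠ 0 := by
    exact_mod_cast (Nat.fib_pos.mpr (by omega)).ne'
  have hev : (Nat.fib (d + 2) : ℝ) * (1 - (pPoly d (p + 1)).eval x) = Nat.fib (d + 2) -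
      (Nat.fib (d + 2) * pOne d (p + 1) * (1 - x) +
        Nat.fib (d + 2) * pTwo d (p + 1) * (1 - x ^ 2)) := by
    simp only [pPoly, eval_add, eval_mul, eval_C, eval_sub, eval_one, eval_X, eval_pow]
    ring
  rw [hev]
  rcases p with _ | q
  -- the first wire, which has only a right neighbour
  · obtain ⟨m, rfl⟩ : ∃ m, d = 1 + 1 + m := ⟨d - 2, by omega⟩
    rw [transfer_add fun j hj => nbrWeight_eq_one (by omega)]
    simp only [pOne, pTwo, zero_add, true_or, if_true, mul_div_cancel₀ _ hf]
    rw [show 1 + 1 + m + 2 = m + 4 by omega, show 1 + 1 + m - 1 = m + 1 by omega]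
    simp only [transfer, nbrWeight, Nat.fib_add_two (n := m + 2), Nat.fib_add_two (n := m + 1),
      Nat.fib_add_two (n := m)]
    push_cast
    norm_num
    ring
  · have hlow : transfer (nbrWeight x (q + 1)) q = Nat.fib (q + 2) :=
      transfer_eq_fib fun j hj => nbrWeight_eq_one (by omega)
    have hmid : transfer (nbrWeight x (q + 1)) (q + 1) = Nat.fib (q + 2) + x * Nat.fib (q + 1) := by
      rcases q with _ | q
      · simp [transfer, nbrWeight]
      · rw [transfer, hlow, transfer_eq_fib fun j hj => nbrWeight_eq_one (by omega),
          nbrWeight, if_pos (by omega)]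
    have hself : transfer (nbrWeight x (q + 1)) (q + 2) =
        2 * Nat.fib (q + 2) + x * Nat.fib (q + 1) := by
      rw [transfer, hmid, hlow, nbrWeight, if_neg (by omega)]
      ring
    -- the last wire, and then the wires with two neighbours
    rcases (show d = q + 2 ∨ q + 3 ≤ d by omega) with rfl | hd3
    · simp only [pOne, pTwo, or_true, if_true, mul_div_cancel₀ _ hf]
      rw [hself, show q + 2 - 1 = q + 1 by omega, Nat.fib_add_two (n := q + 2),
        Nat.fib_add_two (n := q + 1)]
      push_cast
      ring
    · obtain ⟨m, rfl⟩ : ∃ m, d = (q + 2) + 1 + m := ⟨d - (q + 3), by omega⟩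
      rw [transfer_add fun j hj => nbrWeight_eq_one (by omega), transfer, hself, hmid, nbrWeight,
        if_pos (by omega), pOne, pTwo, if_neg (by omega), if_neg (by omega),
        mul_div_cancel₀ _ hf, mul_div_cancel₀ _ hf]
      have h1 : Nat.fib (q + 2 + 1 + m + 2) =
          Nat.fib (q + 2) * Nat.fib (m + 2) + Nat.fib (q + 3) * Nat.fib (m + 3) := by
        rw [show q + 2 + 1 + m + 2 = (q + 2) + (m + 2) + 1 by omega, Nat.fib_add]
      rw [h1, show q + 1 + 1 - 1 = q + 1 by omega,
        show q + 2 + 1 + m - (q + 1 + 1) = m + 1 by omega]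
      simp only [Nat.fib_add_two (n := m + 1), Nat.fib_add_two (n := q + 1),
        Nat.fib_add_two (n := m)]
      push_cast
      ring

/-! ### Messages of the CAC checks -/

theorem cacPairUpdate_eq_none {a b : Bool} {m : Msg} (h : a ≠ b) :
    cacPairUpdate a b m = none ↔ m ≠ some (!a) := by
  simp [cacPairUpdate, h]

theorem cacUpdate_eq_none {φ : Bool} {d : ℕ} {m : Fin d → Msg} {i : Fin d} :
    cacUpdate (altRun φ d) m i = none ↔
      ∀ j : Fin d, (j.val + 1 = i.val ∨ j.val = i.val + 1) → m j ≠ some (!altRun φ d j) := by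
  have hl : ((if _h : 0 < i.val then
      cacPairUpdate (altRun φ d ⟨i.val - 1, by omega⟩) (altRun φ d i) (m ⟨i.val - 1, by omega⟩)
    else none) = none) ↔ ∀ j : Fin d, j.val + 1 = i.val → m j ≠ some (!altRun φ d j) := by
    split_ifs with h
    · rw [cacPairUpdate_eq_none (altRun_ne_of_adjacent φ (by dsimp only; omega))]
      refine ⟨fun hm j hj => ?_, fun hm => hm _ (by dsimp only; omega)⟩
      have hji : j = ⟨i.val - 1, by omega⟩ := Fin.ext (by dsimp only; omega)
      rwa [hji]
    · exact ⟨fun _ j hj => by omega, fun _ => rfl⟩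
  have hr : ((if h : i.val + 1 < d then
      cacPairUpdate (altRun φ d ⟨i.val + 1, h⟩) (altRun φ d i) (m ⟨i.val + 1, h⟩)
    else none) = none) ↔ ∀ j : Fin d, j.val = i.val + 1 → m j ≠ some (!altRun φ d j) := by
    split_ifs with h
    · rw [cacPairUpdate_eq_none (altRun_ne_of_adjacent φ rfl).symm]
      refine ⟨fun hm j hj => ?_, fun hm => hm _ rfl⟩
      obtain rfl : j = ⟨i.val + 1, h⟩ := Fin.ext hj
      exact hm
    · exact ⟨fun _ j hj => by omega, fun _ => rfl⟩
  rw [cacUpdate, Option.or_eq_none_iff, hl, hr, ← forall_and]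
  exact forall_congr' fun j => or_imp.symm

/-- A wire stays unknown at its CAC check exactly if no neighbouring wire is known to switch; this
turns the erasure indicator into a product over the wires of the run. -/
theorem erased_cacUpdate {φ : Bool} {d : ℕ} (m : Fin d → Msg) (i : Fin d) :
    erased (cacUpdate (altRun φ d) m i) =
      ∏ j : Fin d, if (j.val + 1 = i.val ∨ j.val = i.val + 1) → m j ≠ some (!altRun φ d j)
        then 1 else 0 := by
  rw [Finset.prod_ite_zero]
  simp only [erased, cacUpdate_eq_none, Finset.mem_univ, true_imp_iff, Finset.prod_const_one]

/-- The probability that a wire with bit `b` and past value `a` is not known to switch. -/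
theorem Erasing.expect_ne {α : Type} {msg : α → Msg} {Y : Bool → PMF α} {x : ℝ}
    (h : Erasing msg Y x) (a b : Bool) (i j : ℕ) :
    (expect (Y b) fun t => if (j + 1 = i ∨ j = i + 1) → msg t ≠ some (!a) then 1 else 0) =
      if b ≠ a then nbrWeight (ENNReal.ofReal x) i j else 1 := by
  by_cases hadj : j + 1 = i ∨ j = i + 1
  · simp only [hadj, true_imp_iff, nbrWeight, if_true]
    by_cases hb : b = a
    · rw [if_neg (not_not.mpr hb)]
      refine (expect_congr (h := fun _ => 1) ?_).trans (expect_const _ 1)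
      refine fun t ht => if_pos fun hm => ?_
      have := h.correct b t ht _ hm
      subst hb
      simp at this
    · rw [if_pos hb, ← h.erased_eq b]
      refine expect_congr fun t ht => ?_
      obtain rfl : b = !a := by revert hb; cases a <;> cases b <;> simp
      rcases hm : msg t with _ | v
      · simp [erased]
      · have := h.correct _ t ht v hm
        simp [erased, this]
  · simp [hadj, nbrWeight, expect_const]

theorem mem_cacWords {d : ℕ} {a w : Fin d → Bool} : w ∈ cacWords a ↔ IsCACWord a w := by
  simp [cacWords]

theorem correct_cacUpdate {d : ℕ} {a w : Fin d → Bool} (hw : IsCACWord a w) {m : Fin d → Msg}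
    (hm : ∀ j, Correct (w j) (m j)) (i : Fin d) : Correct (w i) (cacUpdate a m i) := by
  have key (j : Fin d) (hj : j.val = i.val + 1 ∨ i.val = j.val + 1) :
      Correct (w i) (cacPairUpdate (a j) (a i) (m j)) := by
    intro v hv
    unfold cacPairUpdate at hv
    split_ifs at hv with h
    obtain rfl := Option.some.inj hv
    have h2 := hm j _ h.2
    by_contra hne
    have hop : a j ≠ w j := by rw [← h2]; simp
    rcases hj with hj | hj
    · exact hw i j hj ⟨hne, hop, h.1.symm⟩
    · exact hw j i hj ⟨hop, hne, h.1⟩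
  intro v hv
  rw [cacUpdate, Option.or_eq_some_iff] at hv
  rcases hv with hv | ⟨-, hv⟩
  · split_ifs at hv with h
    exact key _ (Or.inr (by dsimp only; omega)) v hv
  · split_ifs at hv with h
    exact key _ (Or.inl rfl) v hv

section Laws

variable (E : Ensemble) (ε : unitInterval)

theorem correct_cacToInfo {Y : Bool → PMF EccToInfo} {y : ℝ} (hY : Erasing EccToInfo.msg Y y) :
    ∀ t ∈ (cacToInfoLaw E ε Y).support, Correct t.bit t.msg := by
  intro t ht
  simp only [cacToInfoLaw, Ensemble.run, PMF.mem_support_bind_iff, PMF.mem_support_map_iff] at ht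
  obtain ⟨ω, ⟨n, -, φ, -, w, hw, pos, -, rfl⟩, f, hf, rfl⟩ := ht
  rw [PMF.mem_support_uniformOfFinset_iff, mem_cacWords] at hw
  rw [CacToInfo.msg]
  refine correct_cacUpdate hw (fun j => ?_) pos
  refine Fin.succAboveCases pos ?_ (fun j => ?_) j
  · rw [Fin.insertNth_apply_same]
    exact correct_none _
  · rw [Fin.insertNth_apply_succAbove]
    exact (erasing_infoToCac E ε hY).correct _ _ (mem_support_indep hf j)

/-- The probability that the message of the CAC check to the distinguished wire of a given run is an
erasure. -/
theorem expect_erased_others {Y : Bool → PMF EccToInfo} {x : ℝ}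
    (hx : Erasing InfoToCac.msg (infoToCacLaw E ε Y) x) (ω : Run) :
    (expect (indep fun j => infoToCacLaw E ε Y (ω.word (ω.pos.succAbove j))) fun f =>
        erased (CacToInfo.node ω f).msg) =
      ∏ j, if ω.word j ≠ altRun ω.phase (ω.n + 1) j then
        nbrWeight (ENNReal.ofReal x) ω.pos j else 1 := by
  simp only [CacToInfo.msg, Run.past, erased_cacUpdate, Fin.prod_univ_succAbove _ ω.pos,
    Fin.insertNth_apply_same, Fin.insertNth_apply_succAbove]
  rw [nbrWeight_eq_one (by omega), ite_self, one_mul]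
  have hnone (b : Bool) : (none : Msg) ≠ some b := by simp
  simp only [hnone, imp_true_iff, if_true, one_mul, ne_eq, not_false_eq_true]
  rw [expect_indep_prod (fun j => infoToCacLaw E ε Y (ω.word (ω.pos.succAbove j))) fun j t =>
    if ((ω.pos.succAbove j).val + 1 = ω.pos.val ∨ (ω.pos.succAbove j).val = ω.pos.val + 1) →
      t.msg ≠ some (!altRun ω.phase (ω.n + 1) (ω.pos.succAbove j)) then 1 else 0]
  exact Finset.prod_congr rfl fun j _ => hx.expect_ne _ _ _ _

/-- The probability that the message to a random wire of a run of length `d` is an erasure, if the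
messages to the CAC check are erasures with probability `x`. -/
noncomputable def unknownProb (x : ℝ) (d : ℕ) : ℝ :=
  (∑ p : Fin d, transfer (nbrWeight x p) d) / (d * Nat.fib (d + 2))

theorem nbrWeight_mem {x : ℝ} (h0 : 0 ≤ x) (h1 : x ≤ 1) (i j : ℕ) :
    0 ≤ nbrWeight x i j ∧ nbrWeight x i j ≤ 1 := by
  unfold nbrWeight
  split_ifs
  · exact ⟨h0, h1⟩
  · simp

theorem unknownProb_nonneg {x : ℝ} (h0 : 0 ≤ x) (h1 : x ≤ 1) (d : ℕ) : 0 ≤ unknownProb x d :=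
  div_nonneg (Finset.sum_nonneg fun p _ =>
    (transfer_ofReal (fun j => (nbrWeight_mem h0 h1 p j).1) d).1) (by positivity)

theorem unknownProb_le_one {x : ℝ} (h0 : 0 ≤ x) (h1 : x ≤ 1) (d : ℕ) : unknownProb x d ≤ 1 := by
  refine div_le_one_of_le₀ ?_ (by positivity)
  refine (Finset.sum_le_sum fun (p : Fin d) _ =>
    transfer_le_fib (fun j => (nbrWeight_mem h0 h1 p j).1)
      (fun j => (nbrWeight_mem h0 h1 p j).2) d).trans_eq ?_
  simp

theorem one_sub_unknownProb (x : ℝ) {d : ℕ} (hd : 2 ≤ d) :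
    1 - unknownProb x d = (∑ i ∈ Finset.Icc 1 d, (pPoly d i).eval x) / d := by
  have hf : (Nat.fib (d + 2) : ℝ) ≠ 0 := by
    exact_mod_cast (Nat.fib_pos.mpr (by omega)).ne'
  have hd0 : (d : ℝ) ≠ 0 := by
    exact_mod_cast (by omega : d ≠ 0)
  have hsum : ∑ i ∈ Finset.Icc 1 d, (pPoly d i).eval x =
      ∑ p : Fin d, (pPoly d (p + 1)).eval x := by
    rw [← Finset.sum_range fun p => (pPoly d (p + 1)).eval x, Finset.range_eq_Ico,
      Finset.sum_Ico_add' (fun i => (pPoly d i).eval x) 0 d 1]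
    rfl
  rw [unknownProb, Finset.sum_congr rfl fun p _ => transfer_nbrWeight x hd p.2, ← Finset.mul_sum,
    Finset.sum_sub_distrib, hsum]
  simp only [Finset.sum_const, Finset.card_univ, Fintype.card_fin, nsmul_eq_mul, mul_one]
  field_simp
  ring

theorem expect_erased_cacToInfo {Y : Bool → PMF EccToInfo} {x : ℝ}
    (hx : Erasing InfoToCac.msg (infoToCacLaw E ε Y) x) :
    (expect (cacToInfoLaw E ε Y) fun t => erased t.msg) =
      expect E.cacEdgeLaw fun d => ENNReal.ofReal (unknownProb x (d - 1 + 1)) := by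
  simp only [cacToInfoLaw, expect_bind, expect_map, expect_erased_others E ε hx, Ensemble.run,
    expect_uniformOfFinset, expect_uniformOfFintype]
  congr 1
  funext d
  generalize d - 1 = n
  have hφ (φ : Bool) : ((cacWords (altRun φ (n + 1))).card : ℝ≥0∞)⁻¹ *
      ∑ w ∈ cacWords (altRun φ (n + 1)), (Fintype.card (Fin (n + 1)) : ℝ≥0∞)⁻¹ *
        ∑ p : Fin (n + 1), ∏ j, (if w j ≠ altRun φ (n + 1) j then
          nbrWeight (ENNReal.ofReal x) p j else 1) =
      ENNReal.ofReal (unknownProb x (n + 1)) := by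
    rw [← Finset.mul_sum, Finset.sum_comm, card_cacWords, Fintype.card_fin]
    have ht (p : Fin (n + 1)) : ∑ w ∈ cacWords (altRun φ (n + 1)), ∏ j,
        (if w j ≠ altRun φ (n + 1) j then nbrWeight (ENNReal.ofReal x) p j else 1) =
        ENNReal.ofReal (transfer (nbrWeight x p) (n + 1)) := by
      rw [← (transfer_ofReal (fun j => (nbrWeight_mem hx.nonneg hx.le_one p j).1) _).2,
        sum_cacWords φ (nbrWeight (ENNReal.ofReal x) p)]
      congr 1
      funext j
      simp only [nbrWeight]
      split_ifs <;> simp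
    have hF : (0 : ℝ) < Nat.fib (n + 1 + 2) := by exact_mod_cast Nat.fib_pos.mpr (by omega)
    rw [Finset.sum_congr rfl fun p _ => ht p,
      ← ENNReal.ofReal_sum_of_nonneg fun (p : Fin (n + 1)) _ =>
      (transfer_ofReal (fun j => (nbrWeight_mem hx.nonneg hx.le_one p j).1) _).1, unknownProb,
      ENNReal.ofReal_div_of_pos (by positivity), ENNReal.ofReal_mul (Nat.cast_nonneg _),
      ENNReal.ofReal_natCast, ENNReal.ofReal_natCast, ENNReal.div_eq_inv_mul, ← mul_assoc,
      ENNReal.mul_inv (by simp) (by simp), mul_comm (Nat.cast (n + 1 : ℕ) : ℝ≥0∞)⁻¹]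
  simp only [hφ, Finset.sum_const, Finset.card_univ, nsmul_eq_mul]
  rw [← mul_assoc, ENNReal.inv_mul_cancel (by simp) (by simp), one_mul]

/-! ### The degree distribution of the CAC part -/

theorem rhoTilde_nonneg (d : ℕ) : 0 ≤ rhoTilde E.rate d := by
  have h := E.rate_gt
  unfold rhoTilde
  split_ifs
  · exact le_rfl
  · rw [sub_nonneg, div_le_one (by linarith)]
    linarith
  · have : 0 < E.rate := by linarith
    positivity

theorem hasSum_mul_runProb :
    HasSum (fun d : ℕ => (d : ℝ) * runProb E.rate d) (2 * E.rate / (2 * E.rate - 1)) := by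
  have h1 : 2 * E.rate - 1 ≠ 0 := by linarith [E.rate_gt]
  have hg := hasSum_coe_mul_geometric_of_norm_lt_one (r := (1 / 2 : ℝ)) (by norm_num)
  rw [← hasSum_nat_add_iff' 2] at hg ⊢
  have e : (fun n => ((n + 2 : ℕ) : ℝ) * runProb E.rate (n + 2)) =
      fun n : ℕ => ((n + 2 : ℕ) : ℝ) * (1 / 2) ^ (n + 2) / (2 * E.rate - 1) := by
    funext n
    rw [runProb, if_neg (by omega), if_neg (by omega)]
    ring
  rw [e]
  have hv : 2 * E.rate / (2 * E.rate - 1) -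
      ∑ d ∈ Finset.range 2, (d : ℝ) * runProb E.rate d =
      (1 / 2 / (1 - 1 / 2) ^ 2 - ∑ d ∈ Finset.range 2, (d : ℝ) * (1 / 2) ^ d) /
        (2 * E.rate - 1) := by
    simp only [Finset.sum_range_succ, Finset.sum_range_zero, runProb]
    norm_num
    field_simp
    ring
  rw [hv]
  exact hg.div_const _

theorem cacEdgeLaw_apply (d : ℕ) :
    E.cacEdgeLaw d = ENNReal.ofReal (rhoTilde E.rate d) := by
  have h1 : 0 < 2 * E.rate - 1 := by linarith [E.rate_gt]
  have h2 : 0 < E.rate := by linarith [E.rate_gt]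
  have e (d : ℕ) : (d : ℝ≥0∞) * E.runLaw d = ENNReal.ofReal ((d : ℝ) * runProb E.rate d) := by
    rw [ENNReal.ofReal_mul (Nat.cast_nonneg d), ENNReal.ofReal_natCast]
    rfl
  have hs := hasSum_mul_runProb E
  rw [Ensemble.cacEdgeLaw, PMF.normalize_apply]
  simp only [e]
  rw [← ENNReal.ofReal_tsum_of_nonneg
    (fun d => mul_nonneg (Nat.cast_nonneg d) (runProb_nonneg E.rate_gt d)) hs.summable, hs.tsum_eq,
    ← div_eq_mul_inv, ← ENNReal.ofReal_div_of_pos (by positivity)]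
  congr 1
  unfold runProb rhoTilde
  split_ifs with h0 hd
  · simp
  · subst hd
    push_cast
    field_simp
    ring
  · rw [pow_succ]
    field_simp

theorem hasSum_rhoTilde : HasSum (rhoTilde E.rate) 1 := by
  have h := E.cacEdgeLaw.tsum_coe
  simp only [cacEdgeLaw_apply] at h
  have hs := ENNReal.hasSum_toReal (f := fun d => ENNReal.ofReal (rhoTilde E.rate d))
    (by rw [h]; simp)
  simp only [ENNReal.toReal_ofReal (rhoTilde_nonneg E _)] at hs
  convert hs using 1
  have h' := congrArg ENNReal.toReal h
  rw [ENNReal.tsum_toReal_eq fun _ => ENNReal.ofReal_ne_top] at h'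
  simp only [ENNReal.toReal_ofReal (rhoTilde_nonneg E _), ENNReal.toReal_one] at h'
  exact h'.symm

/-- The contribution of the CAC checks of degree `n + 2` to the probability that a message from a
CAC check is known. -/
noncomputable def cacTerm (x : ℝ) (n : ℕ) : ℝ :=
  rhoTilde E.rate (n + 2) / ((n + 2 : ℕ) : ℝ) *
    ∑ i ∈ Finset.Icc 1 (n + 2), (pPoly (n + 2) i).eval x

theorem cacTerm_eq (x : ℝ) (n : ℕ) :
    cacTerm E x n = rhoTilde E.rate (n + 2) * (1 - unknownProb x (n + 2)) := by
  rw [one_sub_unknownProb x (by omega), cacTerm]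
  ring

theorem norm_cacTerm_le {x : ℝ} (h0 : 0 ≤ x) (h1 : x ≤ 1) (n : ℕ) :
    ‖cacTerm E x n‖ ≤ rhoTilde E.rate (n + 2) := by
  have hu0 := unknownProb_nonneg h0 h1 (n + 2)
  have hu1 := unknownProb_le_one h0 h1 (n + 2)
  have hr := rhoTilde_nonneg E (n + 2)
  rw [cacTerm_eq, Real.norm_of_nonneg (mul_nonneg hr (by linarith))]
  exact mul_le_of_le_one_right hr (by linarith)

theorem continuous_cacTerm (n : ℕ) : Continuous fun x => cacTerm E x n := by
  unfold cacTerm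
  fun_prop

theorem unknownProb_one (x : ℝ) : unknownProb x 1 = 1 := by
  have h : Nat.fib 3 = 2 := rfl
  simp [unknownProb, transfer, nbrWeight, h]

theorem summable_rhoTilde_add_two : Summable fun n => rhoTilde E.rate (n + 2) :=
  (summable_nat_add_iff 2).mpr (hasSum_rhoTilde E).summable

theorem hasSum_cacTerm {Y : Bool → PMF EccToInfo} {x : ℝ}
    (hx : Erasing InfoToCac.msg (infoToCacLaw E ε Y) x) :
    HasSum (cacTerm E x) (1 - erasureProb ((cacToInfoLaw E ε Y).map CacToInfo.msg)) := by
  have hterm (d : ℕ) : E.cacEdgeLaw d * ENNReal.ofReal (unknownProb x (d - 1 + 1)) =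
      ENNReal.ofReal (rhoTilde E.rate d * unknownProb x d) := by
    rw [cacEdgeLaw_apply, ENNReal.ofReal_mul (rhoTilde_nonneg E d)]
    rcases d with _ | d
    · simp [rhoTilde]
    · rfl
  have hpos (d : ℕ) : 0 ≤ rhoTilde E.rate d * unknownProb x d :=
    mul_nonneg (rhoTilde_nonneg E d) (unknownProb_nonneg hx.nonneg hx.le_one d)
  have hs : Summable fun d => rhoTilde E.rate d * unknownProb x d :=
    (hasSum_rhoTilde E).summable.of_nonneg_of_le hpos fun d =>
      mul_le_of_le_one_right (rhoTilde_nonneg E d) (unknownProb_le_one hx.nonneg hx.le_one d)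
  rw [erasureProb_eq, expect_erased_cacToInfo E ε hx, expect]
  simp only [hterm]
  rw [← ENNReal.ofReal_tsum_of_nonneg hpos hs, ENNReal.toReal_ofReal (tsum_nonneg hpos)]
  have h := (hasSum_rhoTilde E).sub hs.hasSum
  rw [← hasSum_nat_add_iff' 2] at h
  have e : cacTerm E x = fun n => rhoTilde E.rate (n + 2) -
      rhoTilde E.rate (n + 2) * unknownProb x (n + 2) := by
    funext n
    rw [cacTerm_eq, mul_sub, mul_one]
  rw [e]
  simpa [Finset.sum_range_succ, unknownProb_one, rhoTilde] using h

end Laws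

/-! ### The recursions for a finite number of exchanges -/

section Rounds

variable (E : Ensemble) (ε : unitInterval) (π : PMF Bool)

theorem erasureProb_infoToEcc {Y : Bool → PMF EccToInfo} {y : ℝ} (hY : Erasing EccToInfo.msg Y y) :
    erasureProb ((infoToEccLaw E ε Y).map InfoToEcc.msg) =
      ε * erasureProb ((cacToInfoLaw E ε Y).map CacToInfo.msg) * E.lam.eval y := by
  have h : 0 ≤ ε * E.lam.eval y :=
    mul_nonneg ε.2.1 (eval_nonneg (edgePoly_nonneg E.L_nonneg E.L_mean) hY.nonneg)
  rw [erasureProb_eq, erasureProb_eq, expect_erased_infoToEcc E ε hY, ENNReal.toReal_mul,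
    ENNReal.toReal_ofReal h]
  ring

theorem erasureProb_le_one (μ : PMF Msg) : erasureProb μ ≤ 1 :=
  ENNReal.toReal_le_of_le_ofReal zero_le_one (by simpa using μ.coe_le_one none)

theorem ofReal_erasureProb {α : Type} (μ : PMF α) (f : α → Msg) :
    (expect μ fun a => erased (f a)) = ENNReal.ofReal (erasureProb (μ.map f)) := by
  rw [erasureProb_eq, ENNReal.ofReal_toReal]
  exact ne_top_of_le_ne_top ENNReal.one_ne_top (expect_erased_le_one μ f)

theorem expect_known_infoToEcc (Y : Bool → PMF EccToInfo) :
    (expect (infoToEccLaw E ε Y) fun t => known t.msg) =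
      ENNReal.ofReal (1 - erasureProb ((infoToEccLaw E ε Y).map InfoToEcc.msg)) :=
  expect_known ENNReal.toReal_nonneg (ofReal_erasureProb _ _)

theorem erasing_parityToEcc_round {Y : Bool → PMF EccToInfo} {y : ℝ}
    (hY : Erasing EccToInfo.msg Y y) (i : ℕ) :
    Erasing ParityToEcc.msg (parityToEccLaw E ε (infoToEccLaw E ε Y) i)
      (chainRec ε
        (E.R.eval (1 - erasureProb ((infoToEccLaw E ε Y).map InfoToEcc.msg))) i) :=
  erasing_parityToEcc E ε (erasureProb_le_one _) (expect_known_infoToEcc E ε Y)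
    (correct_infoToEcc E ε hY (correct_cacToInfo E ε hY)) i

theorem erasing_round (s r : ℕ) :
    Erasing EccToInfo.msg (roundLaw E ε π s r) (yECC E ε π s r) := by
  have h : ∃ y, Erasing EccToInfo.msg (roundLaw E ε π s r) y := by
    induction r with
    | zero => exact ⟨1, erasing_silent⟩
    | succ r ih =>
      obtain ⟨y, hY⟩ := ih
      exact ⟨_, erasing_eccToInfo E ε (erasureProb_le_one _) (expect_known_infoToEcc E ε _)
        (correct_infoToEcc E ε hY (correct_cacToInfo E ε hY))
        (erasing_parityToEcc_round E ε hY s) π⟩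
  obtain ⟨y, hY⟩ := h
  have := hY.erasureProb_bind E.run Run.bit
  rw [yECC, this]
  exact hY

theorem yECC_zero (s : ℕ) : yECC E ε π s 0 = 1 :=
  erasing_silent.erasureProb_bind E.run Run.bit

theorem xCAC_eq (s r : ℕ) : xCAC E ε π s r = ε * E.L.eval (yECC E ε π s r) :=
  (erasing_infoToCac E ε (erasing_round E ε π s r)).erasureProb_bind E.run Run.bit

theorem erasing_xCAC (s r : ℕ) :
    Erasing InfoToCac.msg (infoToCacLaw E ε (roundLaw E ε π s r)) (xCAC E ε π s r) := by
  rw [xCAC_eq]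
  exact erasing_infoToCac E ε (erasing_round E ε π s r)

theorem hasSum_yCAC (s r : ℕ) :
    HasSum (cacTerm E (xCAC E ε π s r)) (1 - yCAC E ε π s r) :=
  hasSum_cacTerm E ε (erasing_xCAC E ε π s r)

theorem xECC_eq (s r : ℕ) :
    xECC E ε π s r = ε * yCAC E ε π s r * E.lam.eval (yECC E ε π s r) :=
  erasureProb_infoToEcc E ε (erasing_round E ε π s r)

theorem xP_eq_chainRec (s r i : ℕ) :
    xP E ε π s r i = chainRec ε (E.R.eval (1 - xECC E ε π s r)) i :=
  (erasing_parityToEcc_round E ε (erasing_round E ε π s r) i).erasureProb_bind π id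

theorem yP_eq (s r i : ℕ) :
    yP E ε π s r i = 1 - (1 - xP E ε π s r i) * E.R.eval (1 - xECC E ε π s r) := by
  have hY := erasing_round E ε π s r
  rw [xP_eq_chainRec]
  exact (erasing_eccToParity E ε (erasureProb_le_one _) (expect_known_infoToEcc E ε _)
    (correct_infoToEcc E ε hY (correct_cacToInfo E ε hY))
    (erasing_parityToEcc_round E ε hY i)).erasureProb_bind π id

theorem xP_zero (s r : ℕ) : xP E ε π s r 0 = ε := xP_eq_chainRec E ε π s r 0

theorem xP_succ (s r i : ℕ) : xP E ε π s r (i + 1) = ε * yP E ε π s r i := by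
  rw [yP_eq, xP_eq_chainRec, xP_eq_chainRec, chainRec]

theorem yECC_succ (s r : ℕ) :
    yECC E ε π s (r + 1) =
      1 - (1 - xP E ε π s r s) ^ 2 * E.rho.eval (1 - xECC E ε π s r) := by
  have hY := erasing_round E ε π s r
  rw [xP_eq_chainRec]
  exact (erasing_eccToInfo E ε (erasureProb_le_one _) (expect_known_infoToEcc E ε _)
    (correct_infoToEcc E ε hY (correct_cacToInfo E ε hY))
    (erasing_parityToEcc_round E ε hY s) π).erasureProb_bind E.run Run.bit

/-! ### Exchanges until convergence -/

/-- The limit of the recursion on the accumulate chain. For `e = 1` no parity message is ever known,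
also in the case `q = 1`, where every number is a fixed point. -/
noncomputable def chainLimit (e q : ℝ) : ℝ := if e = 1 then 1 else e * (1 - q) / (1 - e * q)

theorem chainLimit_fixed {e q : ℝ} (he : 0 ≤ e ∧ e ≤ 1) (hq : 0 ≤ q ∧ q ≤ 1) :
    chainLimit e q = e * (1 - (1 - chainLimit e q) * q) := by
  unfold chainLimit
  split_ifs with h
  · simp [h]
  · have : e * q < 1 := by
      have := lt_of_le_of_ne he.2 h
      nlinarith [mul_le_of_le_one_right he.1 hq.2]
    have : 1 - e * q ≠ 0 := by linarith
    field_simp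
    ring

/-- The distance to the fixed point shrinks by the factor `e * q` in each exchange. -/
theorem chainRec_sub_chainLimit {e q : ℝ} (he : 0 ≤ e ∧ e ≤ 1) (hq : 0 ≤ q ∧ q ≤ 1) (s : ℕ) :
    chainRec e q s - chainLimit e q = (e * q) ^ s * (e - chainLimit e q) := by
  induction s with
  | zero => simp [chainRec]
  | succ s ih =>
    have h := chainLimit_fixed he hq
    rw [chainRec, pow_succ]
    linear_combination e * q * ih - h

theorem tendsto_chainLimit {e q : ℝ} (he : 0 ≤ e ∧ e ≤ 1) (hq : 0 ≤ q ∧ q ≤ 1) {u : ℕ → ℝ}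
    (h : Tendsto u atTop (𝓝 q)) :
    Tendsto (fun s => chainLimit e (u s)) atTop (𝓝 (chainLimit e q)) := by
  unfold chainLimit
  split_ifs with h1
  · exact tendsto_const_nhds
  · have : e * q < 1 := by
      have := lt_of_le_of_ne he.2 h1
      nlinarith [mul_le_of_le_one_right he.1 hq.2]
    exact ((h.const_sub 1).const_mul e).div ((h.const_mul e).const_sub 1) (by linarith)

/-- The number of exchanges and the parameter of the recursion tend to their limits together: for
`e < 1` the contraction is uniform in `q`, and for `e = 1` the recursion is constant. -/
theorem tendsto_chainRec {e q : ℝ} (he : 0 ≤ e ∧ e ≤ 1) {u : ℕ → ℝ}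
    (hu : ∀ s, 0 ≤ u s ∧ u s ≤ 1) (h : Tendsto u atTop (𝓝 q)) :
    Tendsto (fun s => chainRec e (u s) s) atTop (𝓝 (chainLimit e q)) := by
  have hq : 0 ≤ q ∧ q ≤ 1 :=
    ⟨ge_of_tendsto' h fun s => (hu s).1, le_of_tendsto' h fun s => (hu s).2⟩
  have hl := tendsto_chainLimit he hq h
  have hd : Tendsto (fun s => (e * u s) ^ s * (e - chainLimit e (u s))) atTop (𝓝 0) := by
    rcases eq_or_lt_of_le he.2 with h1 | h1
    · simp [h1, chainLimit]
    · have hp : Tendsto (fun s => (e * u s) ^ s) atTop (𝓝 0) :=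
        squeeze_zero (fun s => pow_nonneg (mul_nonneg he.1 (hu s).1) s)
          (fun s => pow_le_pow_left₀ (mul_nonneg he.1 (hu s).1)
            (mul_le_of_le_one_right he.1 (hu s).2) s)
          (tendsto_pow_atTop_nhds_zero_of_lt_one he.1 h1)
      simpa using hp.mul (hl.const_sub e)
  have hsum := hd.add hl
  rw [zero_add] at hsum
  refine hsum.congr fun s => ?_
  rw [← chainRec_sub_chainLimit he (hu s) s, sub_add_cancel]

theorem eval_le_one {p : ℝ[X]} (h0 : ∀ k, 0 ≤ p.coeff k) (h1 : p.eval 1 = 1) {x : ℝ} (hx0 : 0 ≤ x)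
    (hx1 : x ≤ 1) : p.eval x ≤ 1 := by
  rw [← h1, Polynomial.eval_eq_sum, Polynomial.eval_eq_sum, Polynomial.sum, Polynomial.sum]
  exact Finset.sum_le_sum fun k _ =>
    mul_le_mul_of_nonneg_left (pow_le_pow_left₀ hx0 hx1 k) (h0 k)

/-- The CAC recursion is continuous, since its terms are continuous and dominated by the degree
distribution. -/
theorem exists_hasSum_cacTerm_of_tendsto {u v : ℕ → ℝ} {x : ℝ} (hu : ∀ s, 0 ≤ u s ∧ u s ≤ 1)
    (h : Tendsto u atTop (𝓝 x)) (hv : ∀ s, HasSum (cacTerm E (u s)) (1 - v s)) :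
    ∃ y, Tendsto v atTop (𝓝 y) ∧ HasSum (cacTerm E x) (1 - y) := by
  have hx : 0 ≤ x ∧ x ≤ 1 :=
    ⟨ge_of_tendsto' h fun s => (hu s).1, le_of_tendsto' h fun s => (hu s).2⟩
  have hb := summable_rhoTilde_add_two E
  have hs : Summable (cacTerm E x) := hb.of_norm_bounded fun n => norm_cacTerm_le E hx.1 hx.2 n
  have ht := tendsto_tsum_of_dominated_convergence (f := fun s n => cacTerm E (u s) n) hb
    (fun n => ((continuous_cacTerm E n).tendsto x).comp h)
    (Eventually.of_forall fun s n => norm_cacTerm_le E (hu s).1 (hu s).2 n)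
  refine ⟨1 - ∑' n, cacTerm E x n, (ht.const_sub 1).congr fun s => ?_, ?_⟩
  · rw [(hv s).tsum_eq, sub_sub_cancel]
  · rw [sub_sub_cancel]
    exact hs.hasSum

/-- The limits in one round, from the limit at its beginning. -/
theorem exists_limits_of_tendsto_yECC {r : ℕ} {y : ℝ}
    (hy : Tendsto (fun s => yECC E ε π s r) atTop (𝓝 y)) :
    ∃ c x, Tendsto (fun s => xECC E ε π s r) atTop (𝓝 x) ∧
      Tendsto (fun s => xP E ε π s r s) atTop (𝓝 (chainLimit ε (E.R.eval (1 - x)))) ∧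
      Tendsto (fun s => yP E ε π s r s) atTop
        (𝓝 (1 - (1 - chainLimit ε (E.R.eval (1 - x))) * E.R.eval (1 - x))) ∧
      Tendsto (fun s => xCAC E ε π s r) atTop (𝓝 (ε * E.L.eval y)) ∧
      Tendsto (fun s => yCAC E ε π s r) atTop (𝓝 c) ∧
      HasSum (cacTerm E (ε * E.L.eval y)) (1 - c) ∧
      x = ε * c * E.lam.eval y ∧
      chainLimit ε (E.R.eval (1 - x)) =
        ε * (1 - (1 - chainLimit ε (E.R.eval (1 - x))) * E.R.eval (1 - x)) ∧
      Tendsto (fun s => yECC E ε π s (r + 1)) atTop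
        (𝓝 (1 - (1 - chainLimit ε (E.R.eval (1 - x))) ^ 2 * E.rho.eval (1 - x))) := by
  have hxC : Tendsto (fun s => xCAC E ε π s r) atTop (𝓝 (ε * E.L.eval y)) := by
    simp only [xCAC_eq]
    exact ((E.L.continuous.tendsto y).comp hy).const_mul _
  obtain ⟨c, hc, hsum⟩ := exists_hasSum_cacTerm_of_tendsto E
    (fun s => ⟨(erasing_xCAC E ε π s r).nonneg, (erasing_xCAC E ε π s r).le_one⟩) hxC
    fun s => hasSum_yCAC E ε π s r
  have hx : Tendsto (fun s => xECC E ε π s r) atTop (𝓝 (ε * c * E.lam.eval y)) := by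
    simp only [xECC_eq]
    exact (hc.const_mul _).mul ((E.lam.continuous.tendsto y).comp hy)
  generalize hxe : ε * c * E.lam.eval y = x at hx
  have hq (p : ℝ[X]) :
      Tendsto (fun s => p.eval (1 - xECC E ε π s r)) atTop (𝓝 (p.eval (1 - x))) :=
    (p.continuous.tendsto _).comp (hx.const_sub 1)
  have hqm (s : ℕ) : 0 ≤ E.R.eval (1 - xECC E ε π s r) ∧ E.R.eval (1 - xECC E ε π s r) ≤ 1 := by
    have h0 : 0 ≤ xECC E ε π s r := ENNReal.toReal_nonneg
    have h1 : xECC E ε π s r ≤ 1 := erasureProb_le_one _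
    exact ⟨eval_nonneg E.R_nonneg (by linarith),
      eval_le_one E.R_nonneg E.R_one (by linarith) (by linarith)⟩
  have hP : Tendsto (fun s => xP E ε π s r s) atTop (𝓝 (chainLimit ε (E.R.eval (1 - x)))) := by
    simp only [xP_eq_chainRec]
    exact tendsto_chainRec ⟨ε.2.1, ε.2.2⟩ hqm (hq E.R)
  refine ⟨c, x, hx, hP, ?_, hxC, hc, hsum, hxe.symm, chainLimit_fixed ⟨ε.2.1, ε.2.2⟩
    ⟨ge_of_tendsto' (hq E.R) fun s => (hqm s).1, le_of_tendsto' (hq E.R) fun s => (hqm s).2⟩, ?_⟩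
  · simp only [yP_eq]
    exact ((hP.const_sub 1).mul (hq E.R)).const_sub 1
  · simp only [yECC_succ]
    exact (((hP.const_sub 1).pow 2).mul (hq E.rho)).const_sub 1

theorem exists_tendsto_yECC (r : ℕ) : ∃ y, Tendsto (fun s => yECC E ε π s r) atTop (𝓝 y) := by
  induction r with
  | zero => exact ⟨1, by simp only [yECC_zero]; exact tendsto_const_nhds⟩
  | succ r ih =>
    obtain ⟨y, hy⟩ := ih
    obtain ⟨c, x, -, -, -, -, -, -, -, -, h⟩ := exists_limits_of_tendsto_yECC E ε π hy
    exact ⟨_, h⟩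

end Rounds

end JointCAC

theorem theorem4 (E : JointCAC.Ensemble) (ε : unitInterval) (π : PMF Bool) :
    -- the degree distribution of the CAC part
    (∀ d, (E.cacEdgeLaw d).toReal = JointCAC.rhoTilde E.rate d) ∧
    -- the recursions, with `s` exchanges on the accumulate chain in each round
    (∀ s, JointCAC.yECC E ε π s 0 = 1 ∧ ∀ r,
      JointCAC.xCAC E ε π s r = ε * E.L.eval (JointCAC.yECC E ε π s r) ∧
      HasSum (fun n : ℕ => JointCAC.rhoTilde E.rate (n + 2) / ((n + 2 : ℕ) : ℝ) *
          ∑ i ∈ Finset.Icc 1 (n + 2), (JointCAC.pPoly (n + 2) i).eval (JointCAC.xCAC E ε π s r))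
        (1 - JointCAC.yCAC E ε π s r) ∧
      JointCAC.xECC E ε π s r =
        ε * JointCAC.yCAC E ε π s r * E.lam.eval (JointCAC.yECC E ε π s r) ∧
      JointCAC.xP E ε π s r 0 = ε ∧
      (∀ i, JointCAC.xP E ε π s r (i + 1) = ε * JointCAC.yP E ε π s r i) ∧
      (∀ i, JointCAC.yP E ε π s r i =
        1 - (1 - JointCAC.xP E ε π s r i) * E.R.eval (1 - JointCAC.xECC E ε π s r)) ∧
      JointCAC.yECC E ε π s (r + 1) =
        1 - (1 - JointCAC.xP E ε π s r s) ^ 2 * E.rho.eval (1 - JointCAC.xECC E ε π s r)) ∧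
    -- the recursions, with the messages on the accumulate chain exchanged until convergence
    ∃ xECC yECC xP yP xCAC yCAC : ℕ → ℝ,
      (∀ r,
        Tendsto (fun s => JointCAC.xECC E ε π s r) atTop (𝓝 (xECC r)) ∧
        Tendsto (fun s => JointCAC.yECC E ε π s r) atTop (𝓝 (yECC r)) ∧
        Tendsto (fun s => JointCAC.xP E ε π s r s) atTop (𝓝 (xP r)) ∧
        Tendsto (fun s => JointCAC.yP E ε π s r s) atTop (𝓝 (yP r)) ∧
        Tendsto (fun s => JointCAC.xCAC E ε π s r) atTop (𝓝 (xCAC r)) ∧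
        Tendsto (fun s => JointCAC.yCAC E ε π s r) atTop (𝓝 (yCAC r))) ∧
      yECC 0 = 1 ∧
      ∀ r,
        xCAC r = ε * E.L.eval (yECC r) ∧
        HasSum (fun n : ℕ => JointCAC.rhoTilde E.rate (n + 2) / ((n + 2 : ℕ) : ℝ) *
            ∑ i ∈ Finset.Icc 1 (n + 2), (JointCAC.pPoly (n + 2) i).eval (xCAC r))
          (1 - yCAC r) ∧
        xECC r = ε * yCAC r * E.lam.eval (yECC r) ∧
        xP r = ε * yP r ∧
        yP r = 1 - (1 - xP r) * E.R.eval (1 - xECC r) ∧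
        yECC (r + 1) = 1 - (1 - xP r) ^ 2 * E.rho.eval (1 - xECC r) := by

  refine ⟨fun d => ?_, fun s => ⟨JointCAC.yECC_zero E ε π s, fun r =>
    ⟨JointCAC.xCAC_eq E ε π s r, JointCAC.hasSum_yCAC E ε π s r, JointCAC.xECC_eq E ε π s r,
      JointCAC.xP_zero E ε π s r, JointCAC.xP_succ E ε π s r, JointCAC.yP_eq E ε π s r,
      JointCAC.yECC_succ E ε π s r⟩⟩, ?_⟩
  · rw [JointCAC.cacEdgeLaw_apply, ENNReal.toReal_ofReal (JointCAC.rhoTilde_nonneg E d)]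
  · choose y hy using JointCAC.exists_tendsto_yECC E ε π
    choose c x hx hP hyP hxC hc hsum hxe hfix hsucc using
      fun r => JointCAC.exists_limits_of_tendsto_yECC E ε π (hy r)
    refine ⟨x, y, _, _, _, c, fun r => ⟨hx r, hy r, hP r, hyP r, hxC r, hc r⟩, ?_,
      fun r => ⟨rfl, hsum r, hxe r, hfix r, rfl, tendsto_nhds_unique (hy (r + 1)) (hsucc r)⟩⟩
    refine tendsto_nhds_unique (hy 0) ?_
    simp only [JointCAC.yECC_zero]
    exact tendsto_const_nhds
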